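/- Let $d\ge 1$. For $z=(x,\omega)\in\mathbb{R}^{2d}$ let $\pi(z)f(t)=e^{2\pi i t\cdot\omega}f(t-x)$ be the time-frequency shift on $L^2(\mathbb{R}^d)$, and for a bounded operator $S$ put $\alpha_z(S)=\pi(z)S\pi(z)^*$ and $\check S=PSP$, where $Pf(t)=f(-t)$. For $f\in L^1(\mathbb{R}^{2d})$ and trace class operators $S,T$ on $L^2(\mathbb{R}^d)$ let $$f\star S=\int_{\mathbb{R}^{2d}} f(z)\,\alpha_z(S)\,dz,\qquad S\star T(z)=\mathrm{tr}\big(S\,\alpha_z(\check T)\big),\qquad \tilde S=S\star\check S .$$ Let $\Omega\subset\mathbb{R}^{2d}$ be compact with Lebesgue measure $|\Omega|>0$, and let $S$ be a positive trace class operator on $L^2(\mathbb{R}^d)$ with $\mathrm{tr}(S)=1$. Let $$\mathrm{ALC}(\tilde S,\Omega)=\frac1{|\Omega|}\int_\Omega\Big(1-\int_{\Omega-z}\tilde S(z')\,dz'\Big)dz ,$$ and let $|\partial\Omega|\in[0,\infty]$ be the perimeter of $\Omega$, that is, $$|\partial\Omega|=\sup\Big\{\int_\Omega \mathrm{div}\,\phi\,dz:\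 \phi\in C^1_c(\mathbb{R}^{2d},\mathbb{R}^{2d}),\ |\phi|\le 1\Big\}.$$ Write $\chi_\Omega\star S=\sum_{k=1}^\infty\lambda_k^\Omega\,h_k^\Omega\otimes h_k^\Omega$ with $(h_k^\Omega)_{k\ge1}$ an orthonormal sequence and $\lambda_1^\Omega\ge\lambda_2^\Omega\ge\dots$, where $(f\otimes g)u=\langle u,g\rangle f$. Let $A_\Omega=\lceil|\Omega|\rceil$ and $T_\Omega=\sum_{k=1}^{A_\Omega}h_k^\Omega\otimes h_k^\Omega$. Then, for every such choice of $(\lambda_k^\Omega)$ and $(h_k^\Omega)$, the operator $\chi_\Omega\star S-T_\Omega$ is of trace class, and with the trace norm $\|A\|_{\mathcal T}=\mathrm{tr}\,(A^*A)^{1/2}$, $$\frac{\|\chi_\Omega\star S-T_\Omega\|_{\mathcal T}}{|\Omega|}\ \le\ \frac{A_\Omega-|\Omega|}{|\Omega|}+2\,\mathrm{ALC}(\tilde S,\Omega)\ \le\ \frac{A_\Omega-|\Omega|}{|\Omega|}+2\,\frac{|\partial\Omega|}{|\Omega|}\int_{\mathbb{R}^{2d}}\tilde S(z)\,|z|\,dz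 ,$$ where the last expression may be $+\infty$. -/

import Mathlib

open MeasureTheory
open scoped ENNReal

noncomputable section

namespace QHA

/-! ### Trace and trace norm on a complex Hilbert space -/

section Trace

variable {H : Type*} [NormedAddCommGroup H] [InnerProductSpace ℂ H] [CompleteSpace H]

/-- The index set of a fixed orthonormal (Hilbert) basis of `H`. -/
def basisSet (H : Type*) [NormedAddCommGroup H] [InnerProductSpace ℂ H] [CompleteSpace H] :
    Set H :=
  Classical.choose (exists_hilbertBasis ℂ H)

/-- A fixed orthonormal (Hilbert) basis of `H`. -/
def onb (H : Type*) [NormedAddCommGroup H] [InnerProductSpace ℂ H] [CompleteSpace H] :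
    HilbertBasis (basisSet H) ℂ H :=
  Classical.choose (Classical.choose_spec (exists_hilbertBasis ℂ H))

/-- The trace norm `‖A‖_𝒯 = tr |A| = ∑ₑ ⟨|A| e, e⟩`, where `|A| = (A* A)^{1/2}` and `e` runs over
an orthonormal basis. The value is `∞` when `A` is not of trace class. The terms are nonnegative
because `|A|` is a positive operator. -/
def traceNorm (A : H →L[ℂ] H) : ℝ≥0∞ :=
  ∑' i, ENNReal.ofReal (inner ℂ (onb H i) (CFC.abs A (onb H i))).re

/-- Trace class operators. -/
def IsTraceClass (A : H →L[ℂ] H) : Prop := traceNorm A < ∞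

/-- The trace `tr A = ∑ₑ ⟨A e, e⟩` (meaningful for trace class operators; Mathlib's inner product
is linear in the second slot). -/
def trace (A : H →L[ℂ] H) : ℂ := ∑' i, inner ℂ (onb H i) (A (onb H i))

/-- `A = ∑ₖ lam k • h k ⊗ h k` (strongly convergent), where `h` is an orthonormal sequence and the
eigenvalues `lam` are listed in nonincreasing order, with multiplicity. -/
structure IsEigenExpansion (A : H →L[ℂ] H) (lam : ℕ → ℝ) (h : ℕ → H) : Prop where
  orthonormal : Orthonormal ℂ h
  antitone : Antitone lam
  hasSum : ∀ f : H, HasSum (fun k => ((lam k : ℂ) * inner ℂ (h k) f) • h k) (A f)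

/-- `∑_{k < n} h k ⊗ h k`, where `(f ⊗ g) u = ⟨u, g⟩ f`. -/
def partialProj (h : ℕ → H) (n : ℕ) : H →L[ℂ] H :=
  ∑ k ∈ Finset.range n, InnerProductSpace.rankOne ℂ (h k) (h k)

end Trace

/-! ### Time-frequency shifts and convolutions of functions and operators -/

section Convolutions

/-- `ℝ^d`. -/
abbrev Space (d : ℕ) := EuclideanSpace ℝ (Fin d)

/-- The phase space `ℝ^{2d}`, with coordinates `z = (x, ω)`. -/
abbrev Phase (d : ℕ) := EuclideanSpace ℝ (Fin d ⊕ Fin d)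

/-- `L²(ℝ^d)`. -/
abbrev L2 (d : ℕ) := Lp ℂ 2 (volume : Measure (Space d))

variable {d : ℕ}

/-- The time component `x` of `z = (x, ω)`. -/
def Phase.pos (z : Phase d) : Space d := WithLp.toLp 2 fun i => z (Sum.inl i)

/-- The frequency component `ω` of `z = (x, ω)`. -/
def Phase.freq (z : Phase d) : Space d := WithLp.toLp 2 fun i => z (Sum.inr i)

/-- `t ↦ e^{2πi t·ω} f(t - x)` for `z = (x, ω)`. -/
def shiftFun (z : Phase d) (f : Space d → ℂ) (t : Space d) : ℂ :=
  Complex.exp (2 * Real.pi * Complex.I * (inner ℝ t (Phase.freq z) : ℝ)) * f (t - Phase.pos z)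

theorem norm_shiftFun (z : Phase d) (f : Space d → ℂ) (t : Space d) :
    ‖shiftFun z f t‖ = ‖f (t - Phase.pos z)‖ := by
  have h : (2 * Real.pi * Complex.I * (inner ℝ t (Phase.freq z) : ℝ) : ℂ)
      = ((2 * Real.pi * inner ℝ t (Phase.freq z) : ℝ) : ℂ) * Complex.I := by
    push_cast; ring
  rw [shiftFun, norm_mul, h, Complex.norm_exp_ofReal_mul_I, one_mul]

theorem memLp_shiftFun (z : Phase d) {f : Space d → ℂ} (hf : MemLp f 2 volume) :
    MemLp (shiftFun z f) 2 volume := by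
  have h1 : MemLp (fun t => f (t - Phase.pos z)) 2 volume :=
    hf.comp_measurePreserving (measurePreserving_sub_right volume (Phase.pos z))
  refine h1.congr_norm ?_ (Filter.Eventually.of_forall fun t => (norm_shiftFun z f t).symm)
  refine AEStronglyMeasurable.mul (Continuous.aestronglyMeasurable ?_) h1.1
  fun_prop

theorem shiftFun_congr (z : Phase d) {f g : Space d → ℂ} (h : f =ᵐ[volume] g) :
    shiftFun z f =ᵐ[volume] shiftFun z g := by
  have := (measurePreserving_sub_right volume (Phase.pos z)).quasiMeasurePreserving.ae_eq_comp h
  filter_upwards [this] with t ht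
  simp only [Function.comp] at ht
  simp [shiftFun, ht]

/-- The time-frequency shift `π(z) f(t) = e^{2πi t·ω} f(t - x)`, `z = (x, ω)`, as a linear isometry
of `L²(ℝ^d)`. -/
def tfShiftIso (z : Phase d) : L2 d →ₗᵢ[ℂ] L2 d where
  toFun f := (memLp_shiftFun z (Lp.memLp f)).toLp (shiftFun z f)
  map_add' f g := by
    rw [← MemLp.toLp_add]
    refine MemLp.toLp_congr _ _ ((shiftFun_congr z (Lp.coeFn_add f g)).trans ?_)
    refine Filter.Eventually.of_forall fun t => ?_
    simp [shiftFun, mul_add]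
  map_smul' c f := by
    rw [RingHom.id_apply, ← MemLp.toLp_const_smul]
    refine MemLp.toLp_congr _ _ ((shiftFun_congr z (Lp.coeFn_smul c f)).trans ?_)
    refine Filter.Eventually.of_forall fun t => ?_
    simp [shiftFun, mul_left_comm]
  norm_map' f := by
    change ‖(memLp_shiftFun z (Lp.memLp f)).toLp (shiftFun z f)‖ = ‖f‖
    rw [Lp.norm_toLp, Lp.norm_def,
      eLpNorm_congr_norm_ae (Filter.Eventually.of_forall (norm_shiftFun z f))]
    congr 1
    exact eLpNorm_comp_measurePreserving (Lp.aestronglyMeasurable f)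
      (measurePreserving_sub_right volume (Phase.pos z))

/-- The time-frequency shift `π(z)` as a bounded operator on `L²(ℝ^d)`. -/
def tfShift (z : Phase d) : L2 d →L[ℂ] L2 d := (tfShiftIso z).toContinuousLinearMap

/-- The translation `α_z(S) = π(z) S π(z)*` of an operator. -/
def opTranslate (z : Phase d) (S : L2 d →L[ℂ] L2 d) : L2 d →L[ℂ] L2 d :=
  tfShift z ∘L S ∘L ContinuousLinearMap.adjoint (tfShift z)

/-- The parity operator `P f(t) = f(-t)` on `L²(ℝ^d)`. -/
def parity (d : ℕ) : L2 d →L[ℂ] L2 d :=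
  (Lp.compMeasurePreservingₗᵢ ℂ (fun t : Space d => -t)
    (Measure.measurePreserving_neg volume)).toContinuousLinearMap

/-- `Š = P S P`. -/
def opCheck (S : L2 d →L[ℂ] L2 d) : L2 d →L[ℂ] L2 d := parity d ∘L S ∘L parity d

/-- The convolution `f ⋆ S = ∫ f(z) α_z(S) dz` of a function and an operator (Bochner integral). -/
def funConvOp (f : Phase d → ℂ) (S : L2 d →L[ℂ] L2 d) : L2 d →L[ℂ] L2 d :=
  ∫ z, f z • opTranslate z S

/-- The convolution `S ⋆ T (z) = tr (S α_z(Ť))` of two operators. -/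
def opConvOp (S T : L2 d →L[ℂ] L2 d) (z : Phase d) : ℂ :=
  trace (S ∘L opTranslate z (opCheck T))

/-- The total correlation function `S̃ = S ⋆ Š`. For a positive trace class operator `S` the complex
number `S ⋆ Š (z)` is real and nonnegative. -/
def totalCorrelation (S : L2 d →L[ℂ] L2 d) (z : Phase d) : ℝ := (opConvOp S (opCheck S) z).re

/-- The operator `χ_Ω ⋆ S`. -/
def locOp (Ω : Set (Phase d)) (S : L2 d →L[ℂ] L2 d) : L2 d →L[ℂ] L2 d :=
  funConvOp (Ω.indicator fun _ => 1) S

/-- The average lack of concentration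
`ALC(F, Ω) = |Ω|⁻¹ ∫_Ω (1 - ∫_{Ω - z} F(z') dz') dz`. -/
def ALC (F : Phase d → ℝ) (Ω : Set (Phase d)) : ℝ :=
  1 / volume.real Ω * ∫ z in Ω, (1 - ∫ z' in (fun w => w - z) '' Ω, F z')

end Convolutions

/-! ### Perimeter -/

section Perimeter

variable {ι : Type*} [Fintype ι] [DecidableEq ι]

/-- The divergence `∑ᵢ ∂ᵢ φᵢ` of a vector field. -/
def divergence (φ : EuclideanSpace ℝ ι → EuclideanSpace ℝ ι) (x : EuclideanSpace ℝ ι) : ℝ :=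
  ∑ i, fderiv ℝ φ x (EuclideanSpace.single i 1) i

/-- The perimeter `|∂Ω|`: the variation of `χ_Ω`, i.e. the supremum of `∫_Ω div φ` over compactly
supported `C¹` vector fields with `|φ| ≤ 1` in the Euclidean norm. It may be `∞`. -/
def perimeter (Ω : Set (EuclideanSpace ℝ ι)) : ℝ≥0∞ :=
  ⨆ (φ : EuclideanSpace ℝ ι → EuclideanSpace ℝ ι) (_ : ContDiff ℝ 1 φ) (_ : HasCompactSupport φ)
    (_ : ∀ x, ‖φ x‖ ≤ 1), ENNReal.ofReal (∫ x in Ω, divergence φ x)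

end Perimeter

end QHA

end

/-!
The operator `B = χ_Ω ⋆ S` satisfies `0 ≤ B ≤ 1`, `tr B = |Ω|` and
`tr B² = ∫_Ω ∫_Ω S̃(y - z) dy dz = |Ω| - |Ω| ALC(S̃, Ω)`. Its difference from the projection onto
the first `A = ⌈|Ω|⌉` eigenvectors is diagonal in `(hₖ)`, so that its trace norm is
`∑_{k < A} (1 - λₖ) + ∑_{k ≥ A} λₖ = (A - |Ω|) + 2 ∑_{k ≥ A} λₖ`. Since `λ` is nonincreasing and
`A ≥ |Ω|`, the tail `∑_{k ≥ A} λₖ` is at most `∑ λₖ (1 - λₖ) = tr B - tr B²`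
(`tsum_abs_sub_indicator_le`), which is the first inequality.

No spectral decomposition of `S` is needed: with `gᵢ = S^{1/2} eᵢ` for an orthonormal basis `(eᵢ)`
one has `S = ∑ gᵢ ⊗ gᵢ` and `∑ ‖gᵢ‖² = tr S = 1` (`exists_hasSum_rankOne`). This expresses the
quadratic form of `B` and the function `S̃(z) = ∑ᵢⱼ |⟨gᵢ, π(z) gⱼ⟩|²` through squared short-time
Fourier transforms, so that sums and integrals of nonnegative functions can be interchanged freely.
Everything then rests on Moyal's identity `∫ |⟨f, π(z) g⟩|² dz = ‖f‖² ‖g‖²`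
(`lintegral_enorm_inner_tfShift_sq`), which gives `B ≤ 1` and `∫ S̃ = 1`, and which is Plancherel's
theorem in the frequency variable. The trace of `B` is computed in a Hilbert basis extending `(hₖ)`
(`tsum_eigenvalue`), because `(hₖ)` is not assumed to be complete. The Bochner integral that defines
`B` exists because `z ↦ π(z)` is strongly continuous (`continuous_tfShift`).

For the second inequality, `∫ S̃ = 1` gives `|Ω| ALC(S̃, Ω) = ∫ S̃(w) |Ω \ (Ω - w)| dw`, and
`|Ω \ (Ω - w)| ≤ |w| |∂Ω|` (`volume_diff_translate_le`): for a test function `ψ` with values in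
`[0, 1]`, the integral `∫_Ω (ψ(x) - ψ(x - w)) dx` is an average over `s ∈ [0, 1]` of the integrals
over `Ω` of the divergences of the fields `x ↦ ψ(x - s w) w`.
-/

noncomputable section

namespace QHA

/-! ### Sums of rank-one operators and their traces -/

section HilbertSpace

variable {H : Type*} [NormedAddCommGroup H] [InnerProductSpace ℂ H]

theorem hasSum_norm_inner_sq {ι : Type*} (b : HilbertBasis ι ℂ H) (x : H) :
    HasSum (fun i => ‖inner ℂ (b i) x‖ ^ 2) (‖x‖ ^ 2) := by
  have h := b.hasSum_inner_mul_inner x x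
  have h2 := Complex.hasSum_re h
  simp only [← inner_conj_symm x (b _), Complex.conj_mul', inner_self_eq_norm_sq_to_K] at h2
  convert h2 using 1
  · ext i; norm_cast
  · norm_cast

theorem tsum_enorm_inner_sq {ι : Type*} (b : HilbertBasis ι ℂ H) (x : H) :
    ∑' i, ‖inner ℂ (b i) x‖ₑ ^ 2 = ‖x‖ₑ ^ 2 := by
  have h := hasSum_norm_inner_sq b x
  have := ENNReal.ofReal_tsum_of_nonneg (fun i => sq_nonneg ‖inner ℂ (b i) x‖) h.summable
  rw [h.tsum_eq] at this
  simpa [ENNReal.ofReal_pow, ofReal_norm] using this.symm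

theorem enorm_inner_comm (x y : H) : ‖inner ℂ x y‖ₑ = ‖inner ℂ y x‖ₑ := by
  rw [← ofReal_norm, ← ofReal_norm, norm_inner_symm]

/-- Families with `∑ ‖gᵢ‖² < ∞` define a norm convergent sum `∑ gᵢ ⊗ gᵢ`. -/
theorem summable_rankOne {ι : Type*} {g : ι → H} (hg : Summable fun i => ‖g i‖ ^ 2)
    [CompleteSpace H] :
    Summable fun i => InnerProductSpace.rankOne ℂ (g i) (g i) := by
  refine Summable.of_norm ?_
  simpa [← sq] using hg

theorem hasSum_inner_apply {ι : Type*} {g : ι → H} {T : H →L[ℂ] H}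
    (hT : HasSum (fun i => InnerProductSpace.rankOne ℂ (g i) (g i)) T) (x y : H) :
    HasSum (fun i => inner ℂ x (g i) * inner ℂ (g i) y) (inner ℂ x (T y)) := by
  have h1 := (hT.mapL (ContinuousLinearMap.apply ℂ H y)).mapL (innerSL ℂ x)
  simpa [inner_smul_right, mul_comm] using h1

theorem hasSum_inner_self_rankOne {ι : Type*} {g : ι → H} {T : H →L[ℂ] H}
    (hT : HasSum (fun i => InnerProductSpace.rankOne ℂ (g i) (g i)) T) (x : H) :
    HasSum (fun i => ((‖inner ℂ x (g i)‖ ^ 2 : ℝ) : ℂ)) (inner ℂ x (T x)) := by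
  refine (hasSum_inner_apply hT x x).congr_fun ?_
  intro i
  rw [← inner_conj_symm (g i) x, Complex.mul_conj']
  norm_cast

/-- The quadratic form of `∑ gᵢ ⊗ gᵢ`. -/
theorem ofReal_inner_self_rankOne {ι : Type*} {g : ι → H} {T : H →L[ℂ] H}
    (hT : HasSum (fun i => InnerProductSpace.rankOne ℂ (g i) (g i)) T) (x : H) :
    ENNReal.ofReal (inner ℂ x (T x)).re = ∑' i, ‖inner ℂ x (g i)‖ₑ ^ 2 := by
  have h := Complex.hasSum_re (hasSum_inner_self_rankOne hT x)
  simp only [Complex.ofReal_re] at h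
  rw [← h.tsum_eq, ENNReal.ofReal_tsum_of_nonneg (fun _ => sq_nonneg _) h.summable]
  simp [ENNReal.ofReal_pow]

variable [CompleteSpace H]

/-- A positive operator `S` is `∑ gᵢ ⊗ gᵢ` with `gᵢ = S^{1/2} eᵢ`, and `∑ ‖gᵢ‖²` is the trace. -/
theorem exists_hasSum_rankOne {S : H →L[ℂ] H} (hS : S.IsPositive) (htc : IsTraceClass S) :
    ∃ g : basisSet H → H, (Summable fun i => ‖g i‖ ^ 2) ∧
      HasSum (fun i => InnerProductSpace.rankOne ℂ (g i) (g i)) S ∧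
      trace S = ((∑' i, ‖g i‖ ^ 2 : ℝ) : ℂ) := by
  have hS0 : 0 ≤ S := (ContinuousLinearMap.nonneg_iff_isPositive S).2 hS
  set R := CFC.sqrt S with hR
  have hRR : R ∘L R = S := CFC.sqrt_mul_sqrt_self S hS0
  have hRp : R.IsPositive := (ContinuousLinearMap.nonneg_iff_isPositive R).1 (CFC.sqrt_nonneg S)
  have hsym : ∀ x y, inner ℂ (R x) y = inner ℂ x (R y) := hRp.isSymmetric
  have hin : ∀ x, inner ℂ x (S x) = ((‖R x‖ ^ 2 : ℝ) : ℂ) := by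
    intro x
    rw [← hRR, ContinuousLinearMap.comp_apply, ← hsym, inner_self_eq_norm_sq_to_K]
    norm_cast
  have hsum : Summable fun i => ‖R (onb H i)‖ ^ 2 := by
    have h1 := htc
    rw [IsTraceClass, traceNorm, CFC.abs_of_nonneg S hS0] at h1
    simp only [hin, Complex.ofReal_re] at h1
    have := ENNReal.summable_toReal h1.ne
    simpa [ENNReal.toReal_ofReal, sq_nonneg] using this
  refine ⟨fun i => R (onb H i), hsum, ?_, ?_⟩
  · have hs := summable_rankOne hsum
    convert hs.hasSum
    ext1 x
    have h1 := (hs.hasSum.mapL (ContinuousLinearMap.apply ℂ H x))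
    have h2 := ((onb H).hasSum_repr (R x)).mapL R
    rw [← ContinuousLinearMap.comp_apply, hRR] at h2
    refine h2.unique ?_
    simpa [HilbertBasis.repr_apply_apply, hsym] using h1
  · rw [trace, Complex.ofReal_tsum]
    exact tsum_congr fun i => hin _

/-- The trace of `(∑ gᵢ ⊗ gᵢ) T` can be computed along the family `(gᵢ)`, which need not be
orthogonal. -/
theorem trace_comp_eq_tsum {ι : Type*} {g : ι → H} (hg : Summable fun i => ‖g i‖ ^ 2)
    {S : H →L[ℂ] H} (hS : HasSum (fun i => InnerProductSpace.rankOne ℂ (g i) (g i)) S)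
    (T : H →L[ℂ] H) : trace (S ∘L T) = ∑' i, inner ℂ (g i) (T (g i)) := by
  set T' := ContinuousLinearMap.adjoint T
  have key : ∀ i, HasSum (fun k => inner ℂ (onb H k) (g i) * inner ℂ (g i) (T (onb H k)))
      (inner ℂ (g i) (T (g i))) := by
    intro i
    have := (onb H).hasSum_inner_mul_inner (T' (g i)) (g i)
    rw [ContinuousLinearMap.adjoint_inner_left] at this
    refine this.congr_fun ?_
    intro k
    rw [ContinuousLinearMap.adjoint_inner_left, mul_comm]
  have hdom : ∀ i, HasSum (fun k => ‖inner ℂ (onb H k) (g i)‖ ^ 2 +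
      ‖inner ℂ (onb H k) (T' (g i))‖ ^ 2) (‖g i‖ ^ 2 + ‖T' (g i)‖ ^ 2) := fun i =>
    (hasSum_norm_inner_sq _ _).add (hasSum_norm_inner_sq _ _)
  have hprod : Summable fun p : ι × basisSet H =>
      inner ℂ (onb H p.2) (g p.1) * inner ℂ (g p.1) (T (onb H p.2)) := by
    refine Summable.of_norm_bounded (g := fun p => ‖inner ℂ (onb H p.2) (g p.1)‖ ^ 2 +
      ‖inner ℂ (onb H p.2) (T' (g p.1))‖ ^ 2) ?_ ?_
    · refine (summable_prod_of_nonneg fun p => by positivity).2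
        ⟨fun i => (hdom i).summable, ?_⟩
      simp only [(hdom _).tsum_eq]
      refine hg.add (Summable.of_nonneg_of_le (fun _ => sq_nonneg _) (fun i => ?_)
        (hg.mul_left (‖T'‖ ^ 2)))
      rw [← mul_pow]
      exact pow_le_pow_left₀ (norm_nonneg _) (T'.le_opNorm _) 2
    · intro p
      rw [norm_mul, ← ContinuousLinearMap.adjoint_inner_left T,
        norm_inner_symm (ContinuousLinearMap.adjoint T (g p.1))]
      nlinarith [sq_nonneg (‖inner ℂ (onb H p.2) (g p.1)‖ - ‖inner ℂ (onb H p.2) (T' (g p.1))‖),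
        sq_nonneg ‖inner ℂ (onb H p.2) (g p.1)‖, sq_nonneg ‖inner ℂ (onb H p.2) (T' (g p.1))‖]
  rw [trace]
  calc _ = ∑' k, ∑' i, inner ℂ (onb H k) (g i) * inner ℂ (g i) (T (onb H k)) :=
        tsum_congr fun k => (hasSum_inner_apply hS _ _).tsum_eq.symm
    _ = ∑' i, ∑' k, inner ℂ (onb H k) (g i) * inner ℂ (g i) (T (onb H k)) :=
        Summable.tsum_comm (f := fun i k =>
          inner ℂ (onb H k) (g i) * inner ℂ (g i) (T (onb H k))) hprod
    _ = _ := tsum_congr fun i => (key i).tsum_eq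

/-- `tr (S T) = ∑ᵢⱼ |⟨gᵢ, kⱼ⟩|²` for `S = ∑ gᵢ ⊗ gᵢ` and `T = ∑ kⱼ ⊗ kⱼ`. -/
theorem ofReal_trace_comp {ι κ : Type*} {g : ι → H} {k : κ → H}
    (hg : Summable fun i => ‖g i‖ ^ 2) {S T : H →L[ℂ] H}
    (hS : HasSum (fun i => InnerProductSpace.rankOne ℂ (g i) (g i)) S)
    (hT : HasSum (fun i => InnerProductSpace.rankOne ℂ (k i) (k i)) T) :
    ENNReal.ofReal (trace (S ∘L T)).re = ∑' i, ∑' j, ‖inner ℂ (g i) (k j)‖ₑ ^ 2 ∧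
      0 ≤ (trace (S ∘L T)).re := by
  have hre : ∀ i, HasSum (fun j => ‖inner ℂ (g i) (k j)‖ ^ 2) (inner ℂ (g i) (T (g i))).re := by
    intro i
    simpa only [Complex.ofReal_re] using Complex.hasSum_re (hasSum_inner_self_rankOne hT (g i))
  have hnn : ∀ i, 0 ≤ (inner ℂ (g i) (T (g i))).re := fun i =>
    (hre i).nonneg fun _ => sq_nonneg _
  have hsum : Summable fun i => inner ℂ (g i) (T (g i)) := by
    refine Summable.of_norm_bounded (hg.mul_left ‖T‖) fun i => ?_
    refine (norm_inner_le_norm _ _).trans ?_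
    nlinarith [T.le_opNorm (g i), norm_nonneg (g i)]
  rw [trace_comp_eq_tsum hg hS, Complex.re_tsum hsum]
  refine ⟨?_, tsum_nonneg hnn⟩
  rw [ENNReal.ofReal_tsum_of_nonneg hnn (Complex.hasSum_re hsum.hasSum).summable]
  exact tsum_congr fun i => ofReal_inner_self_rankOne hT _

end HilbertSpace

/-! ### Orthonormal families and diagonal operators -/

/-- An orthonormal family in a separable space is countable: the balls of radius `1/2` around its
members are disjoint. -/
theorem countable_of_orthonormal {H ι : Type*} [NormedAddCommGroup H] [InnerProductSpace ℂ H]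
    [TopologicalSpace.SeparableSpace H] {v : ι → H} (hv : Orthonormal ℂ v) : Countable ι := by
  refine Pairwise.countable_of_isOpen_disjoint (s := fun i => Metric.ball (v i) (1 / 2)) ?_
    (fun _ => Metric.isOpen_ball) (fun i => ⟨v i, Metric.mem_ball_self (by norm_num)⟩)
  intro i j hij
  refine Metric.ball_disjoint_ball ?_
  have h2 := norm_sub_sq (𝕜 := ℂ) (v i) (v j)
  rw [hv.2 hij, hv.norm_eq_one, hv.norm_eq_one, map_zero] at h2
  rw [dist_eq_norm]
  nlinarith [norm_nonneg (v i - v j)]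

section Diagonal

variable {H : Type*} [NormedAddCommGroup H] [InnerProductSpace ℂ H] [CompleteSpace H]

omit [CompleteSpace H] in
theorem hasSum_inner_right {ι : Type*} {f : ι → H} {a : H} (hf : HasSum f a) (x : H) :
    HasSum (fun k => inner ℂ x (f k)) (inner ℂ x a) :=
  hf.mapL (innerSL ℂ x)

omit [CompleteSpace H] in
theorem inner_diagonal_apply {h : ℕ → H} (ho : Orthonormal ℂ h) {μ : ℕ → ℝ} {D : H →L[ℂ] H}
    (hD : ∀ f, HasSum (fun k => ((μ k : ℂ) * inner ℂ (h k) f) • h k) (D f)) (k : ℕ) (f : H) :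
    inner ℂ (h k) (D f) = μ k * inner ℂ (h k) f := by
  refine (hasSum_inner_right (hD f) (h k)).unique ?_
  convert! hasSum_ite_eq k ((μ k : ℂ) * inner ℂ (h k) f) using 2 with j
  rw [inner_smul_right, (orthonormal_iff_ite.1 ho) k j]
  by_cases hjk : j = k
  · simp [hjk]
  · simp [hjk, Ne.symm hjk]

omit [CompleteSpace H] in
/-- The quadratic form of a diagonal operator. -/
theorem hasSum_re_inner_diagonal {h : ℕ → H} {μ : ℕ → ℝ} {D : H →L[ℂ] H}
    (hD : ∀ f, HasSum (fun k => ((μ k : ℂ) * inner ℂ (h k) f) • h k) (D f)) (f : H) :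
    HasSum (fun k => μ k * ‖inner ℂ (h k) f‖ ^ 2) (inner ℂ f (D f)).re := by
  convert! Complex.hasSum_re (hasSum_inner_right (hD f) f) using 2 with k
  rw [inner_smul_right, mul_assoc, ← inner_conj_symm f (h k), Complex.mul_conj',
    Complex.re_ofReal_mul]
  norm_cast

theorem summable_diagonal {h : ℕ → H} (ho : Orthonormal ℂ h) {μ : ℕ → ℝ} (hμ : Summable μ) :
    Summable fun k => (μ k : ℂ) • InnerProductSpace.rankOne ℂ (h k) (h k) := by
  refine Summable.of_norm ?_
  simpa [norm_smul, ho.norm_eq_one] using hμ.abs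

/-- The trace norm of a diagonal operator `∑ μₖ hₖ ⊗ hₖ` is `∑ |μₖ|`, because its absolute value is
`∑ |μₖ| hₖ ⊗ hₖ`. -/
theorem traceNorm_diagonal {h : ℕ → H} (ho : Orthonormal ℂ h) {μ : ℕ → ℝ} (hμ : Summable μ)
    {D : H →L[ℂ] H}
    (hD : ∀ f, HasSum (fun k => ((μ k : ℂ) * inner ℂ (h k) f) • h k) (D f)) :
    traceNorm D = ∑' k, ‖μ k‖ₑ := by
  set P : H →L[ℂ] H := ∑' k, ((|μ k| : ℝ) : ℂ) • InnerProductSpace.rankOne ℂ (h k) (h k)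
  have hP : ∀ f, HasSum (fun k => (((|μ k| : ℝ) : ℂ) * inner ℂ (h k) f) • h k) (P f) := by
    intro f
    have := (summable_diagonal ho hμ.abs).hasSum.mapL (ContinuousLinearMap.apply ℂ H f)
    simpa only [ContinuousLinearMap.apply_apply, smul_apply,
      InnerProductSpace.rankOne_apply, smul_smul] using this
  -- diagonal operators with real coefficients are symmetric
  have hsym : ∀ {ν : ℕ → ℝ} {T : H →L[ℂ] H},
      (∀ f, HasSum (fun k => ((ν k : ℂ) * inner ℂ (h k) f) • h k) (T f)) →
      ∀ f g, inner ℂ (T f) g = inner ℂ f (T g) := by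
    intro ν T hT f g
    have h2 := (hasSum_inner_right (hT f) g).map (starRingEnd ℂ) Complex.continuous_conj
    rw [inner_conj_symm] at h2
    refine h2.unique ?_
    convert! hasSum_inner_right (hT g) f using 2 with k
    simp only [Function.comp, inner_smul_right, map_mul, inner_conj_symm, Complex.conj_ofReal]
    ring
  have hform := fun f => hasSum_re_inner_diagonal hP f
  have hPpos : P.IsPositive := by
    refine ⟨fun f g => hsym hP f g, fun f => ?_⟩
    rw [ContinuousLinearMap.reApplyInnerSelf_apply, hsym hP]
    exact (hform f).nonneg fun k => by positivity
  have hadj : ContinuousLinearMap.adjoint D = D :=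
    ((ContinuousLinearMap.eq_adjoint_iff D D).2 fun f g => hsym hD f g).symm
  have hPP : P * P = star D * D := by
    rw [ContinuousLinearMap.star_eq_adjoint, hadj]
    ext1 f
    change P (P f) = D (D f)
    refine (hP (P f)).unique ?_
    convert! hD (D f) using 3 with k
    rw [inner_diagonal_apply ho hP, inner_diagonal_apply ho hD, ← mul_assoc, ← mul_assoc]
    norm_cast
    rw [abs_mul_abs_self]
  have habs : CFC.abs D = P := by
    rw [CFC.abs]
    exact CFC.sqrt_unique hPP ((ContinuousLinearMap.nonneg_iff_isPositive P).2 hPpos)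
  rw [traceNorm, habs]
  have h1 : ∀ f, ENNReal.ofReal (inner ℂ f (P f)).re = ∑' k, ‖μ k‖ₑ * ‖inner ℂ f (h k)‖ₑ ^ 2 := by
    intro f
    rw [← (hform f).tsum_eq, ENNReal.ofReal_tsum_of_nonneg (fun _ => by positivity)
      (hform f).summable]
    refine tsum_congr fun k => ?_
    rw [ENNReal.ofReal_mul (abs_nonneg _), ENNReal.ofReal_pow (norm_nonneg _), ofReal_norm,
      enorm_inner_comm, ← Real.norm_eq_abs, ofReal_norm]
  simp only [h1]
  rw [ENNReal.tsum_comm]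
  refine tsum_congr fun k => ?_
  rw [ENNReal.tsum_mul_left, tsum_enorm_inner_sq, ← ofReal_norm (h k), ho.norm_eq_one]
  simp

omit [CompleteSpace H] in
theorem hasSum_sub_partialProj {h : ℕ → H} {lam : ℕ → ℝ} {B : H →L[ℂ] H}
    (hB : IsEigenExpansion B lam h) (n : ℕ) (f : H) :
    HasSum (fun k => (((lam k - if k < n then 1 else 0 : ℝ) : ℂ) * inner ℂ (h k) f) • h k)
      ((B - partialProj h n) f) := by
  have h2 : HasSum (fun k => ((if k < n then 1 else 0 : ℂ) * inner ℂ (h k) f) • h k)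
      (partialProj h n f) := by
    have : partialProj h n f = ∑ k ∈ Finset.range n,
        ((if k < n then 1 else 0 : ℂ) * inner ℂ (h k) f) • h k := by
      rw [partialProj, _root_.sum_apply]
      refine Finset.sum_congr rfl fun k hk => ?_
      simp [Finset.mem_range.1 hk]
    rw [this]
    refine hasSum_sum_of_ne_finset_zero fun k hk => ?_
    simp [Finset.mem_range.not.1 hk]
  change HasSum _ (B f - partialProj h n f)
  convert! (hB.hasSum f).sub h2 using 2 with k
  rw [← sub_smul, ← sub_mul]
  push_cast
  split_ifs <;> simp

/-- For a nonincreasing sequence in `[0, 1]` with sum `m ≤ n`, the `ℓ¹` distance to the indicator of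
the first `n` indices is controlled by `∑ λₖ (1 - λₖ)`. -/
theorem tsum_abs_sub_indicator_le {lam : ℕ → ℝ} (hanti : Antitone lam) (h0 : ∀ k, 0 ≤ lam k)
    (h1 : ∀ k, lam k ≤ 1) {m q : ℝ} (hm : HasSum lam m) (hq : HasSum (fun k => lam k ^ 2) q)
    {n : ℕ} (hn : m ≤ n) :
    ∑' k, |lam k - if k < n then 1 else 0| ≤ n - m + 2 * (m - q) := by
  have hχ : HasSum (fun k => if k < n then (1 : ℝ) else 0) n := by
    have : (n : ℝ) = ∑ k ∈ Finset.range n, if k < n then (1 : ℝ) else 0 := by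
      rw [Finset.sum_congr rfl fun k hk => if_pos (Finset.mem_range.1 hk)]; simp
    rw [this]
    exact hasSum_sum_of_ne_finset_zero fun k hk => by simp [Finset.mem_range.not.1 hk]
  -- the two sides differ by `2 (1 - λₖ) (λₖ - λₙ)` for `k < n` and by `2 λₖ (λₙ - λₖ)` for `k ≥ n`,
  -- both nonnegative by monotonicity; summing leaves `n - m` with a factor `1 - 2 λₙ ≤ 1`
  have hle : ∀ k, |lam k - if k < n then 1 else 0| ≤
      ((if k < n then 1 else 0) - lam k) * (1 - 2 * lam n) + 2 * (lam k - lam k ^ 2) := by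
    intro k
    split_ifs with hk
    · rw [abs_of_nonpos (by linarith [h1 k])]
      nlinarith [h1 k, hanti hk.le]
    · rw [abs_of_nonneg (by linarith [h0 k])]
      nlinarith [h0 k, hanti (not_lt.1 hk)]
  have hR := ((hχ.sub hm).mul_right (1 - 2 * lam n)).add ((hm.sub hq).mul_left 2)
  calc _ ≤ (n - m) * (1 - 2 * lam n) + 2 * (m - q) := by
        have hs := Summable.of_nonneg_of_le (fun _ => abs_nonneg _) hle hR.summable
        exact hasSum_le hle hs.hasSum hR
    _ ≤ _ := by nlinarith [h0 n]

end Diagonal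

/-! ### Perimeter and translations -/

section Perimeter

variable {ι : Type*} [Fintype ι] [DecidableEq ι]

/-- The field `x ↦ ψ (x - v) w` has divergence the derivative of `ψ (· - v)` along `w`. -/
theorem divergence_smul_const {ψ : EuclideanSpace ℝ ι → ℝ} (hψ : ContDiff ℝ 1 ψ)
    (v w x : EuclideanSpace ℝ ι) :
    divergence (fun y => ψ (y - v) • w) x = fderiv ℝ ψ (x - v) w := by
  have hd : HasFDerivAt (fun y => ψ (y - v)) (fderiv ℝ ψ (x - v)) x := by
    exact (hψ.differentiable one_ne_zero (x - v)).hasFDerivAt.comp x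
      ((hasFDerivAt_id x).sub_const v)
  have hw : w = ∑ i, w i • EuclideanSpace.single i (1 : ℝ) := by
    ext j
    simp [Finset.sum_apply, Pi.single_apply]
  rw [divergence, (hd.smul_const w).fderiv]
  conv_rhs => rw [hw, map_sum]
  refine Finset.sum_congr rfl fun i _ => ?_
  simp [mul_comm]

theorem integral_divergence_le_perimeter {Ω : Set (EuclideanSpace ℝ ι)} (hper : perimeter Ω ≠ ∞)
    {φ : EuclideanSpace ℝ ι → EuclideanSpace ℝ ι} (h1 : ContDiff ℝ 1 φ) (h2 : HasCompactSupport φ)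
    (h3 : ∀ x, ‖φ x‖ ≤ 1) : ∫ x in Ω, divergence φ x ≤ (perimeter Ω).toReal := by
  have : ENNReal.ofReal (∫ x in Ω, divergence φ x) ≤ perimeter Ω :=
    le_iSup_of_le φ (le_iSup_of_le h1 (le_iSup_of_le h2 (le_iSup_of_le h3 le_rfl)))
  exact (ENNReal.ofReal_le_iff_le_toReal hper).1 this

/-- Moving a `C¹` test function with values in `[0, 1]` by `w` changes its integral over `Ω` by at
most `|w|` times the perimeter: the change is the integral over `s ∈ [0, 1]` of the integrals over
`Ω` of the divergences of the fields `x ↦ ψ (x - s w) w`. -/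
theorem setIntegral_sub_comp_sub_le {Ω : Set (EuclideanSpace ℝ ι)} (hΩ : IsCompact Ω)
    (hper : perimeter Ω ≠ ∞) {ψ : EuclideanSpace ℝ ι → ℝ} (hψ : ContDiff ℝ 1 ψ)
    (hc : HasCompactSupport ψ) (h01 : ∀ x, ψ x ∈ Set.Icc (0 : ℝ) 1) (w : EuclideanSpace ℝ ι) :
    ∫ x in Ω, (ψ x - ψ (x - w)) ≤ ‖w‖ * (perimeter Ω).toReal := by
  have hcont : Continuous fun p : ℝ × EuclideanSpace ℝ ι => fderiv ℝ ψ (p.2 - p.1 • w) w :=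
    ((hψ.continuous_fderiv one_ne_zero).comp (by fun_prop)).clm_apply continuous_const
  have hftc : ∀ x, ψ x - ψ (x - w) = ∫ s in (0 : ℝ)..1, fderiv ℝ ψ (x - s • w) w := by
    intro x
    have hder : ∀ s ∈ Set.uIcc (0 : ℝ) 1,
        HasDerivAt (fun s : ℝ => -ψ (x - s • w)) (fderiv ℝ ψ (x - s • w) w) s := by
      intro s _
      have h1 : HasDerivAt (fun s : ℝ => x - s • w) (-w) s := by
        simpa using ((hasDerivAt_id s).smul_const w).const_sub x
      have h2 := ((hψ.differentiable one_ne_zero _).hasFDerivAt.comp_hasDerivAt s h1).neg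
      rw [map_neg, neg_neg] at h2
      exact h2
    rw [intervalIntegral.integral_eq_sub_of_hasDerivAt hder
      ((hcont.comp (by fun_prop : Continuous fun s : ℝ => (s, x))).intervalIntegrable _ _)]
    simp
    ring
  have hswap : ∫ x in Ω, (ψ x - ψ (x - w))
      = ∫ s in (0 : ℝ)..1, ∫ x in Ω, fderiv ℝ ψ (x - s • w) w := by
    simp only [hftc]
    rw [intervalIntegral_integral_swap]
    rw [Set.uIoc_of_le zero_le_one]
    have : IntegrableOn (fun p : ℝ × EuclideanSpace ℝ ι => fderiv ℝ ψ (p.2 - p.1 • w) w)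
        (Set.Icc 0 1 ×ˢ Ω) (volume.prod volume) :=
      hcont.continuousOn.integrableOn_compact (isCompact_Icc.prod hΩ)
    rw [Measure.prod_restrict]
    exact this.mono_set (Set.prod_mono_left Set.Ioc_subset_Icc_self)
  have hslice : ∀ s : ℝ, ∫ x in Ω, fderiv ℝ ψ (x - s • w) w ≤ ‖w‖ * (perimeter Ω).toReal := by
    intro s
    rcases eq_or_ne w 0 with rfl | hw
    · simp
    have hw' : 0 < ‖w‖ := norm_pos_iff.2 hw
    have h := integral_divergence_le_perimeter hper
      (φ := fun x => ψ (x - s • w) • (‖w‖⁻¹ • w)) ?_ ?_ ?_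
    · simp only [divergence_smul_const hψ, map_smul, smul_eq_mul] at h
      rw [integral_const_mul, inv_mul_le_iff₀ hw'] at h
      exact h
    · exact (hψ.comp (contDiff_id.sub contDiff_const)).smul contDiff_const
    · have : HasCompactSupport fun x => ψ (x - s • w) :=
        hc.comp_homeomorph (Homeomorph.subRight (s • w))
      exact this.smul_right
    · intro x
      have := h01 (x - s • w)
      rw [norm_smul, norm_smul, norm_inv, norm_norm, inv_mul_cancel₀ hw'.ne', mul_one,
        Real.norm_of_nonneg this.1]
      exact this.2
  rw [hswap]
  have hg : Continuous fun s : ℝ => ∫ x in Ω, fderiv ℝ ψ (x - s • w) w :=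
    continuous_parametric_integral_of_continuous hcont hΩ
  calc _ ≤ ∫ s in (0 : ℝ)..1, ‖w‖ * (perimeter Ω).toReal :=
        intervalIntegral.integral_mono_on zero_le_one (hg.intervalIntegrable _ _)
          intervalIntegrable_const fun s _ => hslice s
    _ = _ := by simp

/-- `|Ω \ (Ω - w)| ≤ |w| |∂Ω|`, by testing with smooth approximations of the indicator function of
`Ω \ (Ω - w)`. -/
theorem volume_diff_translate_le {Ω : Set (EuclideanSpace ℝ ι)} (hΩ : IsCompact Ω)
    (w : EuclideanSpace ℝ ι) :
    volume (Ω \ (fun x => x + w) ⁻¹' Ω) ≤ perimeter Ω * ‖w‖ₑ := by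
  set E := Ω \ (fun x => x + w) ⁻¹' Ω with hE
  rcases eq_or_ne w 0 with rfl | hw
  · simp [hE]
  by_cases hper : perimeter Ω = ∞
  · rw [hper, ENNReal.top_mul (by simpa using hw)]
    exact le_top
  have hΩ' : IsCompact ((fun x => x + w) ⁻¹' Ω) :=
    (Homeomorph.addRight w).isCompact_preimage.2 hΩ
  have hEm : MeasurableSet E := hΩ.measurableSet.diff hΩ'.measurableSet
  have hEfin : volume E ≠ ∞ := (measure_mono_top Set.sdiff_subset).mt hΩ.measure_lt_top.ne
  have hreal : volume.real E ≤ ‖w‖ * (perimeter Ω).toReal := by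
    refine le_of_forall_pos_le_add fun ε hε => ?_
    -- compact `K ⊆ E` and open `U ⊇ K` approximate `E`; `ψ` is `1` on `K` and supported in `U`
    have hε' : ENNReal.ofReal (ε / 2) ≠ 0 := by simpa using hε
    obtain ⟨K, hKE, hK, hEK⟩ := hEm.exists_isCompact_lt_add hEfin hε'
    obtain ⟨U₀, hKU₀, hU₀, hU₀K⟩ := hK.exists_isOpen_lt_add (μ := volume) hε'
    set U := U₀ ∩ Metric.thickening 1 K
    have hU : IsOpen U := hU₀.inter Metric.isOpen_thickening
    have hKU : K ⊆ U := Set.subset_inter hKU₀ (Metric.self_subset_thickening one_pos K)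
    have hUb : Bornology.IsBounded U := hK.isBounded.thickening.subset Set.inter_subset_right
    obtain ⟨ψ, hψd, hψr, hψs, hψ1⟩ := exists_contMDiff_support_eq_eq_one_iff
      (modelWithCornersSelf ℝ (EuclideanSpace ℝ ι)) hU hK.isClosed hKU
    have hψ : ContDiff ℝ 1 ψ := hψd.contDiff.of_le (by exact_mod_cast le_top)
    have h01 : ∀ x, ψ x ∈ Set.Icc (0 : ℝ) 1 := fun x => hψr (Set.mem_range_self x)
    have hc : HasCompactSupport ψ := by
      rw [HasCompactSupport, tsupport, hψs]
      exact hUb.isCompact_closure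
    have hint : Integrable ψ volume := hψ.continuous.integrable_of_hasCompactSupport hc
    have hKfin : volume K ≠ ∞ := hK.measure_lt_top.ne
    have hmain := setIntegral_sub_comp_sub_le hΩ hper hψ hc h01 w
    have hshift : ∫ x in Ω, ψ (x - w) = ∫ x in (fun x => x + w) ⁻¹' Ω, ψ x := by
      have := (measurePreserving_add_right volume w).setIntegral_preimage_emb
        (measurableEmbedding_addRight w) (fun x => ψ (x - w)) Ω
      simpa using this.symm
    rw [integral_sub hint.integrableOn (hint.comp_sub_right w).integrableOn, hshift] at hmain
    have hlow : volume.real K ≤ ∫ x in Ω, ψ x := by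
      calc volume.real K = ∫ x in K, ψ x := by
            rw [setIntegral_congr_fun hK.measurableSet (g := fun _ => (1 : ℝ))
              fun x hx => (hψ1 x).1 hx]
            simp
        _ ≤ _ := setIntegral_mono_set hint.integrableOn
            (Filter.Eventually.of_forall fun x => (h01 x).1)
            (hKE.trans Set.sdiff_subset).eventuallyLE
    -- `K` does not meet `Ω - w`, so only `U \ K` contributes there
    have hup : ∫ x in (fun x => x + w) ⁻¹' Ω, ψ x ≤ ε / 2 := by
      have hUK : volume (U \ K) ≤ ENNReal.ofReal (ε / 2) := by
        refine (measure_mono (Set.sdiff_subset_sdiff_left Set.inter_subset_left)).trans ?_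
        rw [measure_sdiff hKU₀ hK.measurableSet.nullMeasurableSet hKfin]
        exact tsub_le_iff_left.2 hU₀K.le
      have hUm : MeasurableSet (U \ K) := hU.measurableSet.diff hK.measurableSet
      have hUfin : volume (U \ K) ≠ ∞ := ne_top_of_le_ne_top ENNReal.ofReal_ne_top hUK
      have hi : Integrable ((U \ K).indicator fun _ => (1 : ℝ)) volume :=
        (integrable_indicator_iff hUm).2 (integrableOn_const hUfin)
      calc _ ≤ ∫ x in (fun x => x + w) ⁻¹' Ω, (U \ K).indicator (fun _ => (1 : ℝ)) x := by
            refine setIntegral_mono_on hint.integrableOn hi.integrableOn hΩ'.measurableSet ?_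
            intro x hx
            by_cases hxU : x ∈ U
            · have hxK : x ∉ K := fun h => (hKE h).2 hx
              rw [Set.indicator_of_mem (s := U \ K) ⟨hxU, hxK⟩]
              exact (h01 x).2
            · rw [Set.indicator_of_notMem (s := U \ K) fun h => hxU h.1]
              exact (Function.notMem_support.1 (hψs ▸ hxU)).le
        _ ≤ ∫ x, (U \ K).indicator (fun _ => (1 : ℝ)) x :=
            setIntegral_le_integral hi
              (Filter.Eventually.of_forall fun x => Set.indicator_nonneg (by simp) x)
        _ = volume.real (U \ K) := by rw [integral_indicator hUm]; simp
        _ ≤ ε / 2 := ENNReal.toReal_le_of_le_ofReal (by positivity) hUK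
    have hEK' : volume.real E ≤ volume.real K + ε / 2 := by
      rw [Measure.real, Measure.real, ← ENNReal.toReal_ofReal (half_pos hε).le,
        ← ENNReal.toReal_add hKfin ENNReal.ofReal_ne_top]
      exact ENNReal.toReal_mono (by finiteness) hEK.le
    linarith
  rw [← ENNReal.ofReal_toReal hEfin, ← ENNReal.ofReal_toReal hper, ← ofReal_norm, mul_comm,
    ← ENNReal.ofReal_mul (norm_nonneg _)]
  exact ENNReal.ofReal_le_ofReal hreal

end Perimeter

/-! ### Plancherel's theorem for `L¹ ∩ L²` -/

section Plancherel

open scoped FourierTransform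

variable {V : Type*} [NormedAddCommGroup V] [InnerProductSpace ℝ V] [FiniteDimensional ℝ V]
  [MeasurableSpace V] [BorelSpace V]

/-- On `L¹ ∩ L²` the Fourier integral is almost everywhere equal to the `L²` Fourier transform,
since both represent the same tempered distribution. -/
theorem fourier_ae_eq_toLp {F : V → ℂ} (h1 : Integrable F) (h2 : MemLp F 2 volume) :
    𝓕 F =ᵐ[volume] (𝓕 (h2.toLp F) : Lp ℂ 2 (volume : Measure V)) := by
  have hcont : Continuous (𝓕 F) := VectorFourier.fourierIntegral_continuous
    Real.continuous_fourierChar (by exact continuous_inner) h1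
  refine ae_eq_of_integral_contDiff_smul_eq hcont.locallyIntegrable
    ((Lp.memLp _).locallyIntegrable (by norm_num)) fun g hg hgc => ?_
  set G : SchwartzMap V ℂ := (hgc.comp_left (g := ((↑) : ℝ → ℂ)) (by simp)).toSchwartzMap
    (Complex.ofRealCLM.contDiff.comp hg) with hG
  have hGv : ∀ x, G x = (g x : ℂ) := fun x => rfl
  have e1 := congrArg (fun T => T G) (Lp.fourier_toTemperedDistribution_eq (h2.toLp F))
  simp only [TemperedDistribution.fourier_apply, Lp.toTemperedDistribution_apply] at e1
  have e2 : ∫ x, (𝓕 G) x • (h2.toLp F) x = ∫ x, (𝓕 G) x • F x := by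
    refine integral_congr_ae ?_
    filter_upwards [h2.coeFn_toLp] with x hx
    rw [hx]
  have e3 : ∫ x, (𝓕 (G : V → ℂ)) x • F x = ∫ x, G x • 𝓕 F x := by
    have := VectorFourier.integral_fourierIntegral_smul_eq_flip (L := innerₗ V)
      Real.continuous_fourierChar (by exact continuous_inner) (G.integrable (μ := volume)) h1
    rw [flip_innerₗ] at this
    exact this
  rw [e2, SchwartzMap.fourier_coe, e3] at e1
  simpa only [hGv, Complex.real_smul, smul_eq_mul] using e1

/-- `∫ |f|² = ‖f‖²`. -/
theorem lintegral_enorm_sq_eq {X : Type*} [MeasurableSpace X] {μ : Measure X} (f : Lp ℂ 2 μ) :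
    ∫⁻ x, ‖f x‖ₑ ^ 2 ∂μ = ‖f‖ₑ ^ 2 := by
  rw [Lp.enorm_def, eLpNorm_eq_lintegral_rpow_enorm_toReal (by norm_num) (by norm_num),
    ← ENNReal.rpow_natCast, ← ENNReal.rpow_mul]
  norm_num

/-- Plancherel's theorem for functions in `L¹ ∩ L²`. -/
theorem lintegral_enorm_fourier_sq {F : V → ℂ} (h1 : Integrable F) (h2 : MemLp F 2 volume) :
    ∫⁻ w, ‖𝓕 F w‖ₑ ^ 2 = ∫⁻ x, ‖F x‖ₑ ^ 2 := by
  calc _ = ∫⁻ w, ‖(𝓕 (h2.toLp F) : Lp ℂ 2 (volume : Measure V)) w‖ₑ ^ 2 :=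
        lintegral_congr_ae ((fourier_ae_eq_toLp h1 h2).mono fun x hx => by simp only [hx])
    _ = ∫⁻ x, ‖(h2.toLp F) x‖ₑ ^ 2 := by
        rw [lintegral_enorm_sq_eq, lintegral_enorm_sq_eq, ← ofReal_norm, Lp.norm_fourier_eq,
          ofReal_norm]
    _ = _ := lintegral_congr_ae (h2.coeFn_toLp.mono fun x hx => by simp only [hx])

end Plancherel

/-! ### Time-frequency shifts and Moyal's identity -/

section TimeFrequencyShifts

open scoped FourierTransform

variable {d : ℕ}

/-- The point `(x, ω)` of phase space. -/
def Phase.mk (x ω : Space d) : Phase d := WithLp.toLp 2 (Sum.elim x ω)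

@[simp] theorem Phase.pos_mk (x ω : Space d) : Phase.pos (Phase.mk x ω) = x := rfl

@[simp] theorem Phase.freq_mk (x ω : Space d) : Phase.freq (Phase.mk x ω) = ω := rfl

@[simp] theorem Phase.mk_pos_freq (z : Phase d) : Phase.mk (Phase.pos z) (Phase.freq z) = z := by
  ext i
  cases i <;> rfl

theorem Phase.pos_sub (z w : Phase d) : Phase.pos (z - w) = Phase.pos z - Phase.pos w := rfl

theorem Phase.freq_sub (z w : Phase d) : Phase.freq (z - w) = Phase.freq z - Phase.freq w := rfl

theorem Phase.continuous_mk : Continuous fun p : Space d × Space d => Phase.mk p.1 p.2 := by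
  refine (PiLp.continuous_toLp 2 _).comp (continuous_pi fun i => ?_)
  cases i <;> simp only [Sum.elim_inl, Sum.elim_inr] <;> fun_prop

theorem Phase.continuous_pos : Continuous (Phase.pos : Phase d → Space d) := by
  unfold Phase.pos; fun_prop

theorem Phase.continuous_freq : Continuous (Phase.freq : Phase d → Space d) := by
  unfold Phase.freq; fun_prop

theorem Phase.measurePreserving_pos_freq :
    MeasurePreserving (fun z : Phase d => (Phase.pos z, Phase.freq z)) volume
      (volume.prod volume) :=
  ((((EuclideanSpace.volume_preserving_symm_measurableEquiv_toLp (Fin d)).symm _).prod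
    ((EuclideanSpace.volume_preserving_symm_measurableEquiv_toLp (Fin d)).symm _)).comp
    (measurePreserving_sumPiEquivProdPi fun _ : Fin d ⊕ Fin d => (volume : Measure ℝ))).comp
    (EuclideanSpace.volume_preserving_symm_measurableEquiv_toLp (Fin d ⊕ Fin d))

theorem coeFn_tfShift (z : Phase d) (f : L2 d) : tfShift z f =ᵐ[volume] shiftFun z f :=
  (memLp_shiftFun z (Lp.memLp f)).coeFn_toLp

theorem norm_tfShift (z : Phase d) (f : L2 d) : ‖tfShift z f‖ = ‖f‖ := (tfShiftIso z).norm_map f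

theorem enorm_tfShift (z : Phase d) (f : L2 d) : ‖tfShift z f‖ₑ = ‖f‖ₑ := by
  rw [← ofReal_norm, norm_tfShift, ofReal_norm]

theorem inner_tfShift_left (z : Phase d) (f g : L2 d) :
    inner ℂ (tfShift z f) g = ∫ t, (starRingEnd ℂ) (shiftFun z f t) * g t := by
  rw [L2.inner_def]
  refine integral_congr_ae ?_
  filter_upwards [coeFn_tfShift z f] with t ht
  rw [RCLike.inner_apply, ht, mul_comm]

theorem integrable_conj_shiftFun_mul (z : Phase d) (f g : L2 d) :
    Integrable fun t => (starRingEnd ℂ) (shiftFun z f t) * g t := by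
  refine (L2.integrable_inner (𝕜 := ℂ) (tfShift z f) g).congr ?_
  filter_upwards [coeFn_tfShift z f] with t ht
  rw [RCLike.inner_apply, ht, mul_comm]

/-- For fixed `x`, the function `ω ↦ ⟨g, π(x, ω) f⟩` is, up to conjugation, a Fourier transform. -/
theorem inner_tfShift_mk (x ω : Space d) (f g : L2 d) :
    inner ℂ (tfShift (Phase.mk x ω) f) g = 𝓕 (fun t => (starRingEnd ℂ) (f (t - x)) * g t) ω := by
  rw [inner_tfShift_left, Real.fourier_eq]
  refine integral_congr_ae (Filter.Eventually.of_forall fun t => ?_)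
  simp only [shiftFun, Phase.freq_mk, Phase.pos_mk, map_mul, Circle.smul_def, smul_eq_mul,
    Real.fourierChar_apply, ← Complex.exp_conj]
  rw [mul_assoc]
  congr 2
  simp only [Complex.conj_ofReal, Complex.conj_I, map_ofNat]
  push_cast
  ring

theorem integrable_conj_comp_sub_mul (x : Space d) (f g : L2 d) :
    Integrable fun t => (starRingEnd ℂ) (f (t - x)) * g t := by
  have := integrable_conj_shiftFun_mul (Phase.mk x 0) f g
  simpa [shiftFun] using this

/-- Shifts with the same frequency differ by a translation only, up to a unimodular factor. -/
theorem norm_tfShift_sub_tfShift {z z' : Phase d} (h : Phase.freq z = Phase.freq z') (f : L2 d) :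
    ‖tfShift z f - tfShift z' f‖ =
      ‖Lp.compMeasurePreserving _ (measurePreserving_sub_right volume (Phase.pos z)) f -
        Lp.compMeasurePreserving _ (measurePreserving_sub_right volume (Phase.pos z')) f‖ := by
  rw [Lp.norm_def, Lp.norm_def]
  congr 1
  refine eLpNorm_congr_norm_ae ?_
  filter_upwards [Lp.coeFn_sub (tfShift z f) (tfShift z' f), coeFn_tfShift z f, coeFn_tfShift z' f,
    Lp.coeFn_sub (Lp.compMeasurePreserving _ (measurePreserving_sub_right volume (Phase.pos z)) f)
      (Lp.compMeasurePreserving _ (measurePreserving_sub_right volume (Phase.pos z')) f),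
    Lp.coeFn_compMeasurePreserving f (measurePreserving_sub_right volume (Phase.pos z)),
    Lp.coeFn_compMeasurePreserving f (measurePreserving_sub_right volume (Phase.pos z'))]
    with t h1 h2 h3 h4 h5 h6
  rw [h1, h4, Pi.sub_apply, Pi.sub_apply, h2, h3, h5, h6]
  have := norm_shiftFun z (fun s => f s - f (s + Phase.pos z - Phase.pos z')) t
  simp only [shiftFun, mul_sub, sub_add_cancel] at this
  simpa [shiftFun, h] using this

/-- Time-frequency shifts are strongly continuous. -/
theorem continuous_tfShift (f : L2 d) : Continuous fun z => tfShift z f := by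
  rw [continuous_iff_continuousAt]
  intro z₀
  rw [ContinuousAt, tendsto_iff_norm_sub_tendsto_zero]
  set T : Space d → L2 d := fun x =>
    Lp.compMeasurePreserving _ (measurePreserving_sub_right volume x) f with hT
  have hTc : Continuous T := by
    have hc : Continuous fun x : Space d => (⟨fun t => t - x, by fun_prop⟩ : C(Space d, Space d)) :=
      ContinuousMap.continuous_of_continuous_uncurry _ (by
        simp only [Function.uncurry_def, ContinuousMap.coe_mk]
        fun_prop)
    exact Continuous.compMeasurePreservingLp (f := fun _ => f) continuous_const hc
      (fun x => measurePreserving_sub_right volume x) (by norm_num)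
  -- the modulation part: by isometry, weak continuity suffices
  set x₀ := Phase.pos z₀
  have hinner : Continuous fun ω => inner ℂ (tfShift (Phase.mk x₀ ω) f) (tfShift z₀ f) := by
    simp only [inner_tfShift_mk]
    exact VectorFourier.fourierIntegral_continuous Real.continuous_fourierChar
      (by exact continuous_inner) (integrable_conj_comp_sub_mul _ _ _)
  have hmod : Continuous fun ω => ‖tfShift (Phase.mk x₀ ω) f - tfShift z₀ f‖ := by
    have : ∀ ω, ‖tfShift (Phase.mk x₀ ω) f - tfShift z₀ f‖ = √(‖f‖ ^ 2 -
        2 * (inner ℂ (tfShift (Phase.mk x₀ ω) f) (tfShift z₀ f)).re + ‖f‖ ^ 2) := by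
      intro ω
      have := norm_sub_sq (𝕜 := ℂ) (tfShift (Phase.mk x₀ ω) f) (tfShift z₀ f)
      rw [norm_tfShift, norm_tfShift] at this
      rw [← Real.sqrt_sq (norm_nonneg (_ - _)), this]
      rfl
    simp only [this]
    have := Complex.continuous_re.comp hinner
    simp only [Function.comp_def] at this
    fun_prop
  have hbound : Continuous fun z : Phase d => ‖T (Phase.pos z) - T x₀‖ +
      ‖tfShift (Phase.mk x₀ (Phase.freq z)) f - tfShift z₀ f‖ :=
    ((hTc.comp Phase.continuous_pos).sub continuous_const).norm.add
      (hmod.comp Phase.continuous_freq)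
  have hlim := hbound.tendsto z₀
  simp only [x₀, Phase.mk_pos_freq, sub_self, norm_zero, add_zero] at hlim
  refine squeeze_zero (fun _ => norm_nonneg _) (fun z => ?_) hlim
  calc _ ≤ ‖tfShift z f - tfShift (Phase.mk x₀ (Phase.freq z)) f‖ +
        ‖tfShift (Phase.mk x₀ (Phase.freq z)) f - tfShift z₀ f‖ :=
          norm_sub_le_norm_sub_add_norm_sub _ _ _
    _ = _ := by rw [norm_tfShift_sub_tfShift (by simp)]; rfl

/-- The relation `π(z)* π(w) = c π(w - z)` with `|c| = 1`, in weak form. -/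
theorem enorm_inner_tfShift_tfShift (z w : Phase d) (f g : L2 d) :
    ‖inner ℂ (tfShift z f) (tfShift w g)‖ₑ = ‖inner ℂ f (tfShift (w - z) g)‖ₑ := by
  have h1 : inner ℂ (tfShift z f) (tfShift w g) =
      ∫ t, (starRingEnd ℂ) (shiftFun z f t) * shiftFun w g t := by
    rw [inner_tfShift_left]
    refine integral_congr_ae ?_
    filter_upwards [coeFn_tfShift w g] with t ht
    rw [ht]
  have h2 : inner ℂ f (tfShift (w - z) g) = ∫ t, (starRingEnd ℂ) (f t) * shiftFun (w - z) g t := by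
    rw [L2.inner_def]
    refine integral_congr_ae ?_
    filter_upwards [coeFn_tfShift (w - z) g] with t ht
    rw [RCLike.inner_apply, ht, mul_comm]
  set c : ℂ := Complex.exp (((2 * Real.pi *
    inner ℝ (Phase.pos z) (Phase.freq (w - z)) : ℝ) : ℂ) * Complex.I) with hc
  have h3 : inner ℂ (tfShift z f) (tfShift w g) = c * inner ℂ f (tfShift (w - z) g) := by
    rw [h1, h2, ← integral_add_right_eq_self _ (Phase.pos z), ← integral_const_mul]
    refine integral_congr_ae (Filter.Eventually.of_forall fun t => ?_)
    simp only [shiftFun, Phase.freq_sub, Phase.pos_sub, map_mul, ← Complex.exp_conj, hc,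
      add_sub_cancel_right, Complex.conj_ofReal, Complex.conj_I, map_ofNat, inner_add_left,
      inner_sub_right]
    rw [show t - (Phase.pos w - Phase.pos z) = t + Phase.pos z - Phase.pos w by abel]
    have he : ∀ a b c' e : ℂ, Complex.exp a * Complex.exp b = Complex.exp c' * Complex.exp e →
        ∀ u v : ℂ, Complex.exp a * u * (Complex.exp b * v) =
          Complex.exp c' * (u * (Complex.exp e * v)) := by
      intro a b c' e h u v
      linear_combination (u * v) * h
    refine he _ _ _ _ ?_ _ _
    rw [← Complex.exp_add, ← Complex.exp_add]
    congr 1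
    push_cast
    ring
  rw [h3, enorm_mul, ← ofReal_norm c, hc, Complex.norm_exp_ofReal_mul_I]
  simp

/-- Moyal's identity `∫ |⟨f, π(z) g⟩|² dz = ‖f‖² ‖g‖²`: Plancherel's theorem in the frequency
variable, then Tonelli's theorem in the time variable. -/
theorem lintegral_enorm_inner_tfShift_sq (f g : L2 d) :
    ∫⁻ z, ‖inner ℂ f (tfShift z g)‖ₑ ^ 2 = ‖f‖ₑ ^ 2 * ‖g‖ₑ ^ 2 := by
  have hcont : Continuous fun z => ‖inner ℂ f (tfShift z g)‖ₑ ^ 2 := by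
    have := continuous_tfShift g
    fun_prop
  have hfm : Measurable (f : Space d → ℂ) := (Lp.stronglyMeasurable f).measurable
  have hgm : Measurable (g : Space d → ℂ) := (Lp.stronglyMeasurable g).measurable
  have hm : Measurable fun p : Space d × Space d => ‖g (p.2 - p.1)‖ₑ ^ 2 * ‖f p.2‖ₑ ^ 2 := by
    fun_prop
  have htot : ∫⁻ x, ∫⁻ t, ‖g (t - x)‖ₑ ^ 2 * ‖f t‖ₑ ^ 2 = ‖f‖ₑ ^ 2 * ‖g‖ₑ ^ 2 := by
    rw [lintegral_lintegral_swap hm.aemeasurable]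
    have : ∀ t, ∫⁻ x, ‖g (t - x)‖ₑ ^ 2 * ‖f t‖ₑ ^ 2 = ‖g‖ₑ ^ 2 * ‖f t‖ₑ ^ 2 := by
      intro t
      rw [lintegral_mul_const _ (by fun_prop),
        lintegral_sub_left_eq_self (fun s => ‖g s‖ₑ ^ 2) t, lintegral_enorm_sq_eq]
    simp only [this]
    rw [lintegral_const_mul _ (by fun_prop), lintegral_enorm_sq_eq, mul_comm]
  have hfin : ∀ᵐ x, ∫⁻ t, ‖g (t - x)‖ₑ ^ 2 * ‖f t‖ₑ ^ 2 < ∞ := by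
    refine ae_lt_top hm.lintegral_prod_right' ?_
    rw [htot]
    finiteness
  calc ∫⁻ z, ‖inner ℂ f (tfShift z g)‖ₑ ^ 2
      = ∫⁻ p : Space d × Space d, ‖inner ℂ f (tfShift (Phase.mk p.1 p.2) g)‖ₑ ^ 2
          ∂(volume.prod volume) := by
        rw [← Phase.measurePreserving_pos_freq.lintegral_comp]
        · simp
        · exact (hcont.comp Phase.continuous_mk).measurable
    _ = ∫⁻ x, ∫⁻ ω, ‖inner ℂ f (tfShift (Phase.mk x ω) g)‖ₑ ^ 2 :=
        lintegral_prod _ (hcont.comp Phase.continuous_mk).measurable.aemeasurable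
    _ = ∫⁻ x, ∫⁻ t, ‖g (t - x)‖ₑ ^ 2 * ‖f t‖ₑ ^ 2 := by
        refine lintegral_congr_ae ?_
        filter_upwards [hfin] with x hx
        have h1 := integrable_conj_comp_sub_mul x g f
        have hnorm : ∀ t, ‖(starRingEnd ℂ) (g (t - x)) * f t‖ₑ ^ 2 =
            ‖g (t - x)‖ₑ ^ 2 * ‖f t‖ₑ ^ 2 := by
          intro t
          rw [enorm_mul, mul_pow, ← ofReal_norm ((starRingEnd ℂ) _), RCLike.norm_conj, ofReal_norm]
        have h2 : MemLp (fun t => (starRingEnd ℂ) (g (t - x)) * f t) 2 volume := by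
          refine ⟨h1.1, ?_⟩
          rw [eLpNorm_lt_top_iff_lintegral_rpow_enorm_lt_top (by norm_num) (by norm_num)]
          simpa [hnorm, mul_pow] using hx
        simp only [enorm_inner_comm f, inner_tfShift_mk]
        rw [lintegral_enorm_fourier_sq h1 h2]
        simp only [hnorm]
    _ = _ := htot

end TimeFrequencyShifts

/-! ### Correlation functions and localization operators -/

theorem hasSum_of_tsum_ofReal_eq {ι : Type*} {f : ι → ℝ} (hf : ∀ i, 0 ≤ f i) {a : ℝ≥0∞}
    (ha : a ≠ ∞) (h : ∑' i, ENNReal.ofReal (f i) = a) : HasSum f a.toReal := by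
  have h1 := ENNReal.hasSum_toReal (h.trans_ne ha)
  rw [← ENNReal.tsum_toReal_eq fun _ => ENNReal.ofReal_ne_top, h] at h1
  simpa only [ENNReal.toReal_ofReal (hf _)] using h1

/-- The quadratic form commutes with Bochner integration of operators. -/
theorem re_inner_integral_apply {X H : Type*} [MeasurableSpace X] {μ : Measure X}
    [NormedAddCommGroup H] [InnerProductSpace ℂ H] [CompleteSpace H] {A : X → H →L[ℂ] H}
    (hA : Integrable A μ) (f : H) :
    (inner ℂ f ((∫ x, A x ∂μ) f)).re = ∫ x, (inner ℂ f (A x f)).re ∂μ ∧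
      Integrable (fun x => (inner ℂ f (A x f)).re) μ := by
  have h1 : Integrable (fun x => inner ℂ f (A x f)) μ :=
    (hA.apply_continuousLinearMap f).const_inner f
  refine ⟨?_, h1.re⟩
  rw [ContinuousLinearMap.integral_apply hA, ← integral_inner (hA.apply_continuousLinearMap f)]
  exact (integral_re h1).symm

section Correlation

variable {d : ℕ}

instance separableSpace_L2 : TopologicalSpace.SeparableSpace (L2 d) := by
  have : Fact ((2 : ℝ≥0∞) ≠ ∞) := ⟨by norm_num⟩
  infer_instance

instance countable_basisSet : Countable (basisSet (L2 d)) :=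
  countable_of_orthonormal (onb (L2 d)).orthonormal

theorem parity_parity (f : L2 d) : parity d (parity d f) = f := by
  ext1
  have h1 := Lp.coeFn_compMeasurePreserving (parity d f)
    (Measure.measurePreserving_neg (volume : Measure (Space d)))
  have h2 := Lp.coeFn_compMeasurePreserving f
    (Measure.measurePreserving_neg (volume : Measure (Space d)))
  have h3 := (Measure.measurePreserving_neg
    (volume : Measure (Space d))).quasiMeasurePreserving.ae_eq_comp h2
  filter_upwards [h1, h3] with t ht1 ht3
  refine ht1.trans (ht3.trans ?_)
  simp

theorem opCheck_opCheck (S : L2 d →L[ℂ] L2 d) : opCheck (opCheck S) = S := by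
  ext1 f
  simp [opCheck, parity_parity]

theorem hasSum_opTranslate {ι : Type*} {g : ι → L2 d} {S : L2 d →L[ℂ] L2 d}
    (hS : HasSum (fun i => InnerProductSpace.rankOne ℂ (g i) (g i)) S) (z : Phase d) :
    HasSum (fun i => InnerProductSpace.rankOne ℂ (tfShift z (g i)) (tfShift z (g i)))
      (opTranslate z S) := by
  have h := (hS.mul_right (ContinuousLinearMap.adjoint (tfShift z))).mul_left (tfShift z)
  change HasSum _ (tfShift z * (S * ContinuousLinearMap.adjoint (tfShift z)))
  convert! h using 2 with i
  ext1 f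
  simp [ContinuousLinearMap.adjoint_inner_right]

theorem continuous_opTranslate {ι : Type*} {g : ι → L2 d} (hg : Summable fun i => ‖g i‖ ^ 2)
    {S : L2 d →L[ℂ] L2 d}
    (hS : HasSum (fun i => InnerProductSpace.rankOne ℂ (g i) (g i)) S) :
    Continuous fun z => opTranslate z S := by
  simp only [← (hasSum_opTranslate hS _).tsum_eq]
  refine continuous_tsum (fun i => ?_) hg fun i z => ?_
  · have := continuous_tfShift (g i)
    exact (((ContinuousLinearMap.smulRightL ℂ (L2 d) (L2 d)).continuous.comp
      ((innerSL ℂ).continuous.comp this))).clm_apply this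
  · rw [InnerProductSpace.norm_rankOne, norm_tfShift, sq]

/-- The correlation `∑ᵢⱼ |⟨gᵢ, π(z) gⱼ⟩|²` of a family `g`; it is the total correlation function of
`∑ gᵢ ⊗ gᵢ`, with values in `[0, ∞]`. -/
def corr {ι : Type*} (g : ι → L2 d) (z : Phase d) : ℝ≥0∞ :=
  ∑' i, ∑' j, ‖inner ℂ (g i) (tfShift z (g j))‖ₑ ^ 2

theorem measurable_enorm_inner_tfShift_sq (f g : L2 d) :
    Measurable fun z => ‖inner ℂ f (tfShift z g)‖ₑ ^ 2 := by
  have := continuous_tfShift g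
  exact Continuous.measurable (by fun_prop)

theorem measurable_corr {ι : Type*} [Countable ι] (g : ι → L2 d) : Measurable (corr g) :=
  Measurable.tsum fun _ => Measurable.tsum fun _ =>
    measurable_enorm_inner_tfShift_sq _ _

theorem ofReal_totalCorrelation {ι : Type*} {g : ι → L2 d} (hg : Summable fun i => ‖g i‖ ^ 2)
    {S : L2 d →L[ℂ] L2 d}
    (hS : HasSum (fun i => InnerProductSpace.rankOne ℂ (g i) (g i)) S) (z : Phase d) :
    ENNReal.ofReal (totalCorrelation S z) = corr g z ∧ 0 ≤ totalCorrelation S z := by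
  rw [totalCorrelation, opConvOp, opCheck_opCheck]
  exact ofReal_trace_comp hg hS (hasSum_opTranslate hS z)

theorem lintegral_corr {ι : Type*} [Countable ι] {g : ι → L2 d} (hg : ∑' i, ‖g i‖ₑ ^ 2 = 1) :
    ∫⁻ z, corr g z = 1 := by
  simp only [corr]
  rw [lintegral_tsum fun i => (Measurable.tsum fun _ =>
    measurable_enorm_inner_tfShift_sq _ _).aemeasurable]
  have : ∀ i, ∫⁻ z, ∑' j, ‖inner ℂ (g i) (tfShift z (g j))‖ₑ ^ 2 = ‖g i‖ₑ ^ 2 := by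
    intro i
    rw [lintegral_tsum fun j => (measurable_enorm_inner_tfShift_sq _ _).aemeasurable]
    simp only [lintegral_enorm_inner_tfShift_sq]
    rw [ENNReal.tsum_mul_left, hg, mul_one]
  simp only [this, hg]

theorem tsum_enorm_inner_tfShift_tfShift {ι : Type*} (g : ι → L2 d) (z w : Phase d) :
    ∑' i, ∑' j, ‖inner ℂ (tfShift z (g i)) (tfShift w (g j))‖ₑ ^ 2 = corr g (w - z) := by
  simp only [enorm_inner_tfShift_tfShift, corr]

/-- The quadratic form of the localization operator `χ_Ω ⋆ S` with `S = ∑ gᵢ ⊗ gᵢ`. -/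
theorem ofReal_inner_locOp {ι : Type*} {g : ι → L2 d} (hg : Summable fun i => ‖g i‖ ^ 2)
    {S : L2 d →L[ℂ] L2 d}
    (hS : HasSum (fun i => InnerProductSpace.rankOne ℂ (g i) (g i)) S) {Ω : Set (Phase d)}
    (hΩ : IsCompact Ω) (f : L2 d) :
    ENNReal.ofReal (inner ℂ f (locOp Ω S f)).re =
        ∫⁻ z in Ω, ∑' i, ‖inner ℂ f (tfShift z (g i))‖ₑ ^ 2 ∧
      0 ≤ (inner ℂ f (locOp Ω S f)).re := by
  have hint : IntegrableOn (fun z => opTranslate z S) Ω :=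
    (continuous_opTranslate hg hS).continuousOn.integrableOn_compact hΩ
  have hloc : locOp Ω S = ∫ z in Ω, opTranslate z S := by
    rw [locOp, funConvOp, ← integral_indicator hΩ.measurableSet]
    congr 1
    ext1 z
    by_cases hz : z ∈ Ω <;> simp [hz]
  have hre : (inner ℂ f (locOp Ω S f)).re = ∫ z in Ω, (inner ℂ f (opTranslate z S f)).re := by
    rw [hloc]
    exact (re_inner_integral_apply hint f).1
  have hreint := (re_inner_integral_apply hint f).2
  have hform := fun z => ofReal_inner_self_rankOne (hasSum_opTranslate hS z) f
  have hnn : ∀ z, 0 ≤ (inner ℂ f (opTranslate z S f)).re := fun z =>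
    (Complex.hasSum_re (hasSum_inner_self_rankOne (hasSum_opTranslate hS z) f)).nonneg
      fun i => by rw [Complex.ofReal_re]; positivity
  rw [hre]
  refine ⟨?_, integral_nonneg hnn⟩
  rw [ofReal_integral_eq_lintegral_ofReal hreint
    (Filter.Eventually.of_forall hnn)]
  exact lintegral_congr fun z => hform z

end Correlation

/-! ### Eigenvalues and the average lack of concentration -/

section Eigenvalues

variable {d : ℕ} {ι : Type*} [Countable ι] {g : ι → L2 d} {S : L2 d →L[ℂ] L2 d}
  {Ω : Set (Phase d)} {lam : ℕ → ℝ} {h : ℕ → L2 d}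

/-- The quadratic form of `χ_Ω ⋆ S` at `hₖ` is `λₖ`, so `λₖ ≥ 0`; extending the integral to the
whole phase space, `λₖ ≤ 1` follows from Moyal's identity. -/
theorem ofReal_eigenvalue (hg : Summable fun i => ‖g i‖ ^ 2) (hg1 : ∑' i, ‖g i‖ₑ ^ 2 = 1)
    (hS : HasSum (fun i => InnerProductSpace.rankOne ℂ (g i) (g i)) S) (hΩ : IsCompact Ω)
    (hexp : IsEigenExpansion (locOp Ω S) lam h) (k : ℕ) :
    ENNReal.ofReal (lam k) = ∫⁻ z in Ω, ∑' i, ‖inner ℂ (h k) (tfShift z (g i))‖ₑ ^ 2 ∧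
      0 ≤ lam k ∧ lam k ≤ 1 := by
  have hk : (inner ℂ (h k) (locOp Ω S (h k))).re = lam k := by
    rw [inner_diagonal_apply hexp.orthonormal hexp.hasSum, inner_self_eq_norm_sq_to_K,
      hexp.orthonormal.norm_eq_one]
    simp
  obtain ⟨h1, h2⟩ := ofReal_inner_locOp hg hS hΩ (h k)
  rw [hk] at h1 h2
  refine ⟨h1, h2, ?_⟩
  have hk1 : ‖h k‖ₑ = 1 := by rw [← ofReal_norm, hexp.orthonormal.norm_eq_one]; simp
  have : ENNReal.ofReal (lam k) ≤ 1 := by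
    rw [h1]
    refine (setLIntegral_le_lintegral _ _).trans ?_
    rw [lintegral_tsum fun i => (measurable_enorm_inner_tfShift_sq _ _).aemeasurable]
    simp only [lintegral_enorm_inner_tfShift_sq, hk1, one_pow, one_mul, hg1, le_refl]
  exact ENNReal.ofReal_le_one.1 this

/-- `∑ λₖ = |Ω|`: the trace of `χ_Ω ⋆ S`, computed in a Hilbert basis extending the
eigenvectors. -/
theorem tsum_eigenvalue (hg : Summable fun i => ‖g i‖ ^ 2) (hg1 : ∑' i, ‖g i‖ₑ ^ 2 = 1)
    (hS : HasSum (fun i => InnerProductSpace.rankOne ℂ (g i) (g i)) S) (hΩ : IsCompact Ω)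
    (hexp : IsEigenExpansion (locOp Ω S) lam h) :
    ∑' k, ENNReal.ofReal (lam k) = volume Ω := by
  obtain ⟨w, b, hw, hb⟩ := Orthonormal.exists_hilbertBasis_extension
    hexp.orthonormal.toSubtypeRange
  have : Countable w := countable_of_orthonormal b.orthonormal
  obtain ⟨F, hF⟩ : ∃ F : L2 d → ℝ≥0∞,
      ∀ u, F u = ∫⁻ z in Ω, ∑' i, ‖inner ℂ u (tfShift z (g i))‖ₑ ^ 2 := ⟨_, fun _ => rfl⟩
  -- the quadratic form vanishes on the orthogonal complement of the eigenvectors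
  have hzero : ∀ u ∈ w, u ∉ Set.range h → F u = 0 := by
    intro u hu hur
    have hperp : ∀ k, inner ℂ (h k) u = 0 := by
      intro k
      have hne : (⟨h k, hw ⟨k, rfl⟩⟩ : w) ≠ ⟨u, hu⟩ := fun e => hur ⟨k, congrArg Subtype.val e⟩
      have := b.orthonormal.2 hne
      rwa [hb] at this
    have h0 : locOp Ω S u = 0 := by
      refine (hexp.hasSum u).unique ?_
      simp [hperp]
    rw [hF, ← (ofReal_inner_locOp hg hS hΩ u).1, h0, inner_zero_right]
    simp
  calc ∑' k, ENNReal.ofReal (lam k) = ∑' k, F (h k) :=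
        tsum_congr fun k => (ofReal_eigenvalue hg hg1 hS hΩ hexp k).1.trans (hF _).symm
    _ = ∑' u : Set.range h, F u := by
        exact (tsum_range F hexp.orthonormal.linearIndependent.injective).symm
    _ = ∑' u : w, F u := by
        rw [tsum_subtype (Set.range h) F, tsum_subtype w F]
        refine tsum_congr fun u => ?_
        by_cases hu : u ∈ Set.range h
        · rw [Set.indicator_of_mem hu, Set.indicator_of_mem (hw hu)]
        · rw [Set.indicator_of_notMem hu]
          by_cases huw : u ∈ w
          · rw [Set.indicator_of_mem huw, hzero u huw hu]
          · rw [Set.indicator_of_notMem huw]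
    _ = ∫⁻ z in Ω, ∑' u : w, ∑' i, ‖inner ℂ (b u) (tfShift z (g i))‖ₑ ^ 2 := by
        rw [lintegral_tsum fun u => (Measurable.tsum fun _ =>
          measurable_enorm_inner_tfShift_sq _ _).aemeasurable]
        simp only [hF, hb]
    _ = ∫⁻ z in Ω, 1 := by
        refine lintegral_congr fun z => ?_
        rw [ENNReal.tsum_comm]
        simp only [tsum_enorm_inner_sq, enorm_tfShift, hg1]
    _ = volume Ω := by simp

/-- `∑ λₖ² = ∫_Ω ∫_Ω S̃(y - z) dy dz`: the trace of `(χ_Ω ⋆ S)²`. -/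
theorem tsum_eigenvalue_sq (hg : Summable fun i => ‖g i‖ ^ 2) (hg1 : ∑' i, ‖g i‖ₑ ^ 2 = 1)
    (hS : HasSum (fun i => InnerProductSpace.rankOne ℂ (g i) (g i)) S) (hΩ : IsCompact Ω)
    (hexp : IsEigenExpansion (locOp Ω S) lam h) :
    ∑' k, ENNReal.ofReal (lam k ^ 2) = ∫⁻ z in Ω, ∫⁻ y in Ω, corr g (y - z) := by
  have hlam := ofReal_eigenvalue hg hg1 hS hΩ hexp
  have hform : ∀ f, ∑' k, ENNReal.ofReal (lam k) * ‖inner ℂ (h k) f‖ₑ ^ 2 =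
      ∫⁻ y in Ω, ∑' j, ‖inner ℂ f (tfShift y (g j))‖ₑ ^ 2 := by
    intro f
    have hs := hasSum_re_inner_diagonal hexp.hasSum f
    rw [← (ofReal_inner_locOp hg hS hΩ f).1, ← hs.tsum_eq, ENNReal.ofReal_tsum_of_nonneg
      (fun k => mul_nonneg (hlam k).2.1 (sq_nonneg _)) hs.summable]
    refine tsum_congr fun k => ?_
    rw [ENNReal.ofReal_mul (hlam k).2.1, ENNReal.ofReal_pow (norm_nonneg _), ofReal_norm]
  have hm := fun (k : ℕ) (i : ι) => measurable_enorm_inner_tfShift_sq (h k) (g i)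
  calc ∑' k, ENNReal.ofReal (lam k ^ 2)
      = ∑' k, ∫⁻ z in Ω, ∑' i, ENNReal.ofReal (lam k) *
          ‖inner ℂ (h k) (tfShift z (g i))‖ₑ ^ 2 := by
        refine tsum_congr fun k => ?_
        simp only [ENNReal.tsum_mul_left]
        rw [lintegral_const_mul _ (Measurable.tsum (hm k)), ← (hlam k).1, sq,
          ENNReal.ofReal_mul (hlam k).2.1]
    _ = ∫⁻ z in Ω, ∑' i, ∑' k, ENNReal.ofReal (lam k) *
          ‖inner ℂ (h k) (tfShift z (g i))‖ₑ ^ 2 := by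
        rw [← lintegral_tsum fun k =>
          (Measurable.tsum fun i => (hm k i).const_mul _).aemeasurable]
        exact lintegral_congr fun z => ENNReal.tsum_comm
    _ = ∫⁻ z in Ω, ∑' i, ∫⁻ y in Ω, ∑' j, ‖inner ℂ (tfShift z (g i)) (tfShift y (g j))‖ₑ ^ 2 := by
        simp only [hform]
    _ = ∫⁻ z in Ω, ∫⁻ y in Ω, corr g (y - z) := by
        refine lintegral_congr fun z => ?_
        rw [← lintegral_tsum fun i => (Measurable.tsum fun j =>
          measurable_enorm_inner_tfShift_sq _ _).aemeasurable]
        simp only [tsum_enorm_inner_tfShift_tfShift]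

end Eigenvalues

section Concentration

variable {d : ℕ}

theorem setLIntegral_sub_comp {E : Type*} [AddGroup E] [MeasurableSpace E] [MeasurableAdd E]
    {μ : Measure E} [μ.IsAddRightInvariant] (F : E → ℝ≥0∞) (Ω : Set E) (z : E) :
    ∫⁻ x in (fun w => w - z) '' Ω, F x ∂μ = ∫⁻ y in Ω, F (y - z) ∂μ :=
  ((measurePreserving_sub_right μ z).setLIntegral_comp_emb (measurableEmbedding_subRight z) F
    Ω).symm

/-- `|Ω| ALC(F, Ω) = |Ω| - ∫_Ω ∫_Ω F(y - z) dy dz`. -/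
theorem volume_mul_ALC {F : Phase d → ℝ} {f : Phase d → ℝ≥0∞} (hf : Measurable f)
    (hf1 : ∫⁻ z, f z = 1) (hF : ∀ z, F z = (f z).toReal) {Ω : Set (Phase d)} (hΩ : IsCompact Ω)
    (hΩpos : 0 < volume Ω) :
    volume.real Ω * ALC F Ω = volume.real Ω - (∫⁻ z in Ω, ∫⁻ y in Ω, f (y - z)).toReal := by
  have hpos : 0 < volume.real Ω := ENNReal.toReal_pos hΩpos.ne' hΩ.measure_lt_top.ne
  have hfin : ∀ᵐ z, f z < ∞ := ae_lt_top hf (by rw [hf1]; exact ENNReal.one_ne_top)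
  set N : Phase d → ℝ≥0∞ := fun z => ∫⁻ y in Ω, f (y - z) with hN
  have hNm : Measurable N := by
    have : Measurable fun p : Phase d × Phase d => f (p.2 - p.1) := by fun_prop
    exact this.lintegral_prod_right'
  have hN1 : ∀ z, N z ≤ 1 := by
    intro z
    refine (setLIntegral_le_lintegral _ _).trans ?_
    rw [lintegral_sub_right_eq_self f z, hf1]
  have hinner : ∀ z, ∫ x in (fun w => w - z) '' Ω, F x = (N z).toReal := by
    intro z
    simp only [hF]
    rw [integral_toReal hf.aemeasurable (ae_restrict_of_ae hfin), setLIntegral_sub_comp]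
  have hNfin : ∀ z, N z < ∞ := fun z => (hN1 z).trans_lt ENNReal.one_lt_top
  have hNint : IntegrableOn (fun z => (N z).toReal) Ω := by
    refine integrable_toReal_of_lintegral_ne_top hNm.aemeasurable ?_
    refine ((lintegral_mono hN1).trans_lt ?_).ne
    simpa using hΩ.measure_lt_top
  rw [ALC, ← mul_assoc, mul_one_div_cancel hpos.ne', one_mul]
  simp only [hinner]
  have h1 : IntegrableOn (fun _ : Phase d => (1 : ℝ)) Ω := integrableOn_const hΩ.measure_lt_top.ne
  rw [integral_sub h1 hNint,
    integral_toReal hNm.aemeasurable (Filter.Eventually.of_forall hNfin)]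
  simp

/-- `|Ω| - ∫_Ω ∫_Ω f(y - z) dy dz = ∫ f(w) |Ω \ (Ω - w)| dw` is controlled by the perimeter. -/
theorem volume_le_add_perimeter {f : Phase d → ℝ≥0∞} (hf : Measurable f)
    (hf1 : ∫⁻ z, f z = 1) {Ω : Set (Phase d)} (hΩ : IsCompact Ω) :
    volume Ω ≤ (∫⁻ z in Ω, ∫⁻ y in Ω, f (y - z)) + perimeter Ω * ∫⁻ w, f w * ‖w‖ₑ := by
  have hΩm := hΩ.measurableSet
  have hpre : ∀ w : Phase d, MeasurableSet ((fun x => x + w) ⁻¹' Ω) := fun w =>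
    measurable_add_const w hΩm
  have hQ : ∫⁻ z in Ω, ∫⁻ y in Ω, f (y - z) =
      ∫⁻ w, f w * volume (Ω ∩ (fun x => x + w) ⁻¹' Ω) := by
    -- substituting `w = y - z` turns the condition `y ∈ Ω` into `z ∈ Ω - w`
    have h1 : ∀ z, ∫⁻ y in Ω, f (y - z) =
        ∫⁻ w, ((fun x => x + w) ⁻¹' Ω).indicator (fun _ => f w) z := by
      intro z
      rw [← lintegral_indicator hΩm, ← lintegral_add_right_eq_self _ z]
      refine lintegral_congr fun w => ?_
      by_cases hw : w + z ∈ Ω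
      · rw [Set.indicator_of_mem hw, Set.indicator_of_mem (by simpa [add_comm] using hw)]
        simp
      · rw [Set.indicator_of_notMem hw, Set.indicator_of_notMem (by simpa [add_comm] using hw)]
    simp only [h1]
    rw [lintegral_lintegral_swap]
    · refine lintegral_congr fun w => ?_
      rw [lintegral_indicator (hpre w), setLIntegral_const, Measure.restrict_apply (hpre w),
        Set.inter_comm]
    · refine Measurable.aemeasurable ?_
      have : MeasurableSet {p : Phase d × Phase d | p.1 + p.2 ∈ Ω} :=
        (measurable_fst.add measurable_snd) hΩm
      exact (hf.comp measurable_snd).indicator this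
  have hle : ∀ w, f w * volume Ω ≤ f w * volume (Ω ∩ (fun x => x + w) ⁻¹' Ω) +
      perimeter Ω * (f w * ‖w‖ₑ) := by
    intro w
    calc f w * volume Ω = f w * (volume (Ω ∩ (fun x => x + w) ⁻¹' Ω) +
          volume (Ω \ (fun x => x + w) ⁻¹' Ω)) := by rw [measure_inter_add_sdiff _ (hpre w)]
      _ ≤ f w * (volume (Ω ∩ (fun x => x + w) ⁻¹' Ω) + perimeter Ω * ‖w‖ₑ) := by
          gcongr
          exact volume_diff_translate_le hΩ w
      _ = _ := by ring
  have hm : Measurable fun w => f w * ‖w‖ₑ := by fun_prop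
  calc volume Ω = ∫⁻ w, f w * volume Ω := by rw [lintegral_mul_const _ hf, hf1, one_mul]
    _ ≤ ∫⁻ w, (f w * volume (Ω ∩ (fun x => x + w) ⁻¹' Ω) + perimeter Ω * (f w * ‖w‖ₑ)) :=
        lintegral_mono hle
    _ = _ := by
        rw [lintegral_add_right _ (hm.const_mul _), lintegral_const_mul _ hm, hQ]

end Concentration

end QHA

end

theorem mainTheorem2 (d : ℕ) (hd : 1 ≤ d)
    (Ω : Set (QHA.Phase d)) (hΩ : IsCompact Ω) (hΩpos : 0 < volume Ω)
    (S : QHA.L2 d →L[ℂ] QHA.L2 d) (hSpos : S.IsPositive) (hStc : QHA.IsTraceClass S)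
    (hStr : QHA.trace S = 1)
    (lam : ℕ → ℝ) (h : ℕ → QHA.L2 d) (hexp : QHA.IsEigenExpansion (QHA.locOp Ω S) lam h)
    (A : ℕ) (hA : A = ⌈volume.real Ω⌉₊) :
    QHA.IsTraceClass (QHA.locOp Ω S - QHA.partialProj h A) ∧
    (QHA.traceNorm (QHA.locOp Ω S - QHA.partialProj h A)).toReal / volume.real Ω
        ≤ (A - volume.real Ω) / volume.real Ω + 2 * QHA.ALC (QHA.totalCorrelation S) Ω ∧
    (((A - volume.real Ω) / volume.real Ω + 2 * QHA.ALC (QHA.totalCorrelation S) Ω : ℝ) : EReal)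
        ≤ (((A - volume.real Ω) / volume.real Ω : ℝ) : EReal) +
          ((2 * (QHA.perimeter Ω / volume Ω) *
            ∫⁻ z, ENNReal.ofReal (QHA.totalCorrelation S z) * ‖z‖ₑ : ℝ≥0∞) : EReal) := by
  obtain ⟨g, hg, hS, htr⟩ := QHA.exists_hasSum_rankOne hSpos hStc
  have hg1' : ∑' i, ‖g i‖ ^ 2 = 1 := by
    rw [hStr] at htr
    exact_mod_cast htr.symm
  have hg1 : ∑' i, ‖g i‖ₑ ^ 2 = 1 := by
    have := ENNReal.ofReal_tsum_of_nonneg (fun i => sq_nonneg ‖g i‖) hg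
    rw [hg1'] at this
    simpa [ENNReal.ofReal_pow] using this.symm
  have hvfin : volume Ω ≠ ∞ := hΩ.measure_lt_top.ne
  have hvpos : 0 < volume.real Ω := ENNReal.toReal_pos hΩpos.ne' hvfin
  have hcorr := QHA.measurable_corr g
  have hcorr1 := QHA.lintegral_corr hg1
  have htc := QHA.ofReal_totalCorrelation hg hS
  have htc' : ∀ z, QHA.totalCorrelation S z = (QHA.corr g z).toReal := fun z => by
    rw [← (htc z).1, ENNReal.toReal_ofReal (htc z).2]
  obtain ⟨Q, hQ⟩ : ∃ Q : ℝ≥0∞, Q = ∫⁻ z in Ω, ∫⁻ y in Ω, QHA.corr g (y - z) := ⟨_, rfl⟩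
  have hlam := QHA.ofReal_eigenvalue hg hg1 hS hΩ hexp
  have hsum := QHA.tsum_eigenvalue hg hg1 hS hΩ hexp
  have hsumsq := QHA.tsum_eigenvalue_sq hg hg1 hS hΩ hexp
  rw [← hQ] at hsumsq
  have hQle : Q ≤ volume Ω := by
    rw [← hsum, ← hsumsq]
    refine ENNReal.tsum_le_tsum fun k => ENNReal.ofReal_le_ofReal ?_
    nlinarith [(hlam k).2.1, (hlam k).2.2]
  have hQfin : Q ≠ ∞ := ne_top_of_le_ne_top hvfin hQle
  have hm : HasSum lam (volume.real Ω) :=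
    QHA.hasSum_of_tsum_ofReal_eq (fun k => (hlam k).2.1) hvfin hsum
  have hq : HasSum (fun k => lam k ^ 2) Q.toReal :=
    QHA.hasSum_of_tsum_ofReal_eq (fun k => sq_nonneg _) hQfin hsumsq
  have hAv : volume.real Ω ≤ A := hA ▸ Nat.le_ceil _
  have hALC := QHA.volume_mul_ALC hcorr hcorr1 htc' hΩ hΩpos
  rw [← hQ] at hALC
  have hμ : Summable fun k => lam k - if k < A then (1 : ℝ) else 0 := by
    refine hm.summable.sub (summable_of_ne_finset_zero (s := Finset.range A) fun k hk => ?_)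
    simp [Finset.mem_range.not.1 hk]
  have hnorm : QHA.traceNorm (QHA.locOp Ω S - QHA.partialProj h A) =
      ENNReal.ofReal (∑' k, |lam k - if k < A then (1 : ℝ) else 0|) := by
    have h1 := QHA.traceNorm_diagonal hexp.orthonormal hμ (QHA.hasSum_sub_partialProj hexp A)
    rw [h1]
    rw [ENNReal.ofReal_tsum_of_nonneg (fun _ => abs_nonneg _) hμ.abs]
    exact tsum_congr fun k => by rw [← Real.norm_eq_abs, ofReal_norm]
  have hbound := QHA.tsum_abs_sub_indicator_le hexp.antitone (fun k => (hlam k).2.1)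
    (fun k => (hlam k).2.2) hm hq hAv
  refine ⟨?_, ?_, ?_⟩
  · rw [QHA.IsTraceClass, hnorm]
    exact ENNReal.ofReal_lt_top
  · rw [hnorm, ENNReal.toReal_ofReal (tsum_nonneg fun _ => abs_nonneg _), div_add' _ _ _ hvpos.ne']
    gcongr
    linarith
  · rw [EReal.coe_add]
    gcongr
    have hALC' : QHA.ALC (QHA.totalCorrelation S) Ω =
        (volume.real Ω - Q.toReal) / volume.real Ω := by
      rw [← hALC, mul_div_cancel_left₀ _ hvpos.ne']
    have hper := QHA.volume_le_add_perimeter hcorr hcorr1 hΩ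
    rw [← hQ] at hper
    have hle : ENNReal.ofReal (2 * QHA.ALC (QHA.totalCorrelation S) Ω) ≤
        2 * (QHA.perimeter Ω / volume Ω) *
          ∫⁻ z, ENNReal.ofReal (QHA.totalCorrelation S z) * ‖z‖ₑ := by
      simp only [(htc _).1]
      rw [hALC', ENNReal.ofReal_mul zero_le_two, ENNReal.ofReal_div_of_pos hvpos,
        ENNReal.ofReal_sub _ ENNReal.toReal_nonneg, ENNReal.ofReal_toReal hQfin,
        ofReal_measureReal hvfin, ENNReal.ofReal_ofNat, mul_assoc, ENNReal.mul_div_right_comm.symm]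
      gcongr
      exact tsub_le_iff_left.2 hper
    refine le_trans ?_ (EReal.coe_ennreal_le_coe_ennreal_iff.2 hle)
    rw [EReal.coe_ennreal_ofReal]
    exact EReal.coe_le_coe_iff.2 (le_max_left _ _)
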